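/- **Setting.** A time-varying graph (TVG) has a finite node set $V$, lifetime $[0,\infty)$, and, at each date $t$, a simple undirected graph of the edges present at $t$; the dates of presence of each edge form a union of disjoint closed intervals of length at least $\zeta$, where $\zeta>0$ is the constant crossing delay. Its footprint is the graph of all pairs of nodes having at least one contact. The class $\mathcal P$ consists of the TVGs with connected footprint that are periodic: for some $p>0$, the edges present at $t$ and at $t+kp$ are the same for all $t\ge 0$ and all integers $k\ge 1$. A message sent over an edge at $t$ arrives at $t+\zeta$ if the edge is present during all of $[t,t+\zeta]$, and is lost otherwise. A journey from $u$ to $v$ is a walk with crossing dates $t_1,\dots,t_k$, $t_{i+1}\ge t_i+\zeta$, each edge being present during its crossing; it departs at $t_1$ and arrives at $t_k+\zeta$. The temporal distance $\hat d_{x,t}(v)$ is the minimum arrival date over the journeys from $x$ to $v$ departing at $t$ or later, minus $t$ (and $0$ if $v=x$), and the temporal eccentricity of $x$ at $t$ is $\max_v \hat d_{x,t}(v)$. Nodes have unique identifiers and private clocks showing the time since they started. They know $\zeta$ and a number $p^+$, and nothing else about the network in advance; they observe the presence of their own incident edges and the messages that they receive. A protocol determines, from what a node has observed so far, what it sends and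 whether it is in its terminal state. The information to be broadcast is a token, which only a node holding it can forward. The source $x$ is asked to broadcast at a date $r_0$, and then possibly at finitely many later dates $r_1<r_2<\cdots$, each coming after the source has detected termination of the previous broadcast. All nodes have started by date $r_0$. **Theorem (TDB[fastest] is feasible in $\mathcal P$ with a known upper bound on $p$, and the broadcast tree is reusable).** There is a single protocol such that, for every TVG in $\mathcal P$ with a period $p\le p^+$, every source $x$, every choice of identifiers, starting dates and request dates as above, only finitely many messages are sent in bounded time, and every requested broadcast, the first one and all the subsequent ones, satisfies the following. 1. (Termination detection) Within finite time after the request, the source enters a terminal state, when all nodes have received the information; it stays there, sending nothing, until the next request if there is one. 2. (Fastest) If $|V|\ge 2$, the duration between the first global emission of the information, which is not before the request, and its last global reception is the minimum of the durations of all possible broadcasts from $x$, at whatever date of the lifetime. 3. (Foremost from a date of minimum eccentricity) There is a date $s$, not before the request, at which the temporal eccentricity of $x$ is minimum over all dates, such that the information is not emitted before $s$ and every node $v\ne x$ receives it for the first time at date $s+\hat d_{x,s}(v)$. 4. (Reusability) All these broadcasts take place along one and the same tree: there is a spanning tree of the footprint such that, in every one of them, the information is sent only along edges of that tree. -/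

import Mathlib

/-- A time-varying graph on the node set `V`, with lifetime `[0, ∞)` and a constant crossing delay.
`snapshot t` is the simple undirected graph formed by the edges present at date `t`. For every pair
of nodes, the dates of presence form a union of disjoint closed intervals (possibly unbounded to
the right) of length at least the crossing delay. -/
structure TVG (V : Type) where
  delay : ℝ
  delay_pos : 0 < delay
  snapshot : ℝ → SimpleGraph V
  snapshot_of_neg : ∀ t : ℝ, t < 0 → snapshot t = ⊥
  presence_intervals : ∀ u v : V, ∃ I : Set (Set ℝ),
    I.PairwiseDisjoint id ∧
    (∀ J ∈ I, (∃ a b : ℝ, a + delay ≤ b ∧ J = Set.Icc a b) ∨ (∃ a : ℝ, J = Set.Ici a)) ∧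
    ⋃₀ I = {t : ℝ | (snapshot t).Adj u v}

namespace TVG

variable {V : Type}

/-- The footprint: `u` and `v` are adjacent iff they have at least one contact. -/
def footprint (G : TVG V) : SimpleGraph V where
  Adj u v := ∃ t : ℝ, (G.snapshot t).Adj u v
  symm := ⟨fun _ _ ⟨t, h⟩ => ⟨t, h.symm⟩⟩
  loopless := ⟨fun _ ⟨_, h⟩ => h.ne rfl⟩

/-- `p` is a period of the presence schedule. -/
def IsPeriodic (G : TVG V) (p : ℝ) : Prop :=
  0 < p ∧ ∀ t : ℝ, 0 ≤ t → ∀ k : ℕ, 0 < k → G.snapshot t = G.snapshot (t + k * p)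

/-- A message sent from `u` to `v` at date `t` gets through: the edge is present during the whole
of `[t, t + delay]`. -/
def Crossable (G : TVG V) (u v : V) (t : ℝ) : Prop :=
  ∀ t' ∈ Set.Icc t (t + G.delay), (G.snapshot t').Adj u v

/-- `G.Journey u v d a`: there is a (nonempty, finite) journey from `u` to `v` with departure date
`d` and arrival date `a`, i.e. a walk with crossing dates `t₁ = d, …, tₖ = a - delay` such that
`tᵢ + delay ≤ tᵢ₊₁` and each edge is present throughout its crossing. -/
inductive Journey (G : TVG V) : V → V → ℝ → ℝ → Prop
  | single {u v : V} {t : ℝ} (h : G.Crossable u v t) : Journey G u v t (t + G.delay)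
  | extend {u v w : V} {d a t : ℝ} (h : Journey G u v d a) (hat : a ≤ t)
      (hc : G.Crossable v w t) : Journey G u w d (t + G.delay)

/-- `δ` is the temporal distance from `u` to `v` at date `t`: the minimum arrival date over the
journeys departing at `t` or later, minus `t` (and `0` if `u = v`). -/
def IsTemporalDistance (G : TVG V) (u : V) (t : ℝ) (v : V) (δ : ℝ) : Prop :=
  (u = v ∧ δ = 0) ∨
    (u ≠ v ∧ IsLeast {a : ℝ | ∃ d : ℝ, t ≤ d ∧ G.Journey u v d a} (t + δ))

/-- `ε` is the temporal eccentricity of `u` at date `t`: every node has a temporal distance from `u`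
at `t`, and `ε` is the largest of these. -/
def IsTemporalEccentricity (G : TVG V) (u : V) (t ε : ℝ) : Prop :=
  (∀ v : V, ∃ δ : ℝ, G.IsTemporalDistance u t v δ) ∧
    IsGreatest {δ : ℝ | ∃ v : V, G.IsTemporalDistance u t v δ} ε

/-- `s` is a date at which the temporal eccentricity of `u` is minimum, among all the dates of the
lifetime. -/
def IsMinEccentricityDate (G : TVG V) (u : V) (s : ℝ) : Prop :=
  0 ≤ s ∧ ∃ ε : ℝ, G.IsTemporalEccentricity u s ε ∧
    ∀ t : ℝ, 0 ≤ t → ∃ ε' : ℝ, G.IsTemporalEccentricity u t ε' ∧ ε ≤ ε'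

/-- The durations `D` for which a broadcast from `x` is possible, at some date `s` of the lifetime,
with all its emissions at `s` or later and all its receptions at `s + D` or earlier. -/
def broadcastDurations (G : TVG V) (x : V) : Set ℝ :=
  {D : ℝ | 0 ≤ D ∧ ∃ s : ℝ, 0 ≤ s ∧
    ∀ v : V, v ≠ x → ∃ d a : ℝ, G.Journey x v d a ∧ s ≤ d ∧ a ≤ s + D}

end TVG

/-- A packet: a control content of type `M`, together with at most one of the pieces of information
to be broadcast (`item = some k` for the `k`-th one). A protocol never sees what an item contains:
items are tokens, which can be copied and forwarded only by a node that holds them. -/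
structure Packet (M : Type) where
  content : M
  item : Option ℕ

/-- Everything a node knows at some instant. Its clock is private: it shows the time elapsed since
the node started. Nodes and edges are known through the identifiers of the nodes. -/
structure View (M : Type) where
  /-- the identifier of the node -/
  ident : ℕ
  /-- the crossing delay -/
  delay : ℝ
  /-- the known upper bound on the period -/
  periodBound : ℝ
  /-- what the clock shows now -/
  clock : ℝ
  /-- `(k, c)`: the node was asked, when its clock showed `c`, to broadcast item `k` -/
  requests : Set (ℕ × ℝ)
  /-- `(j, c)`: the edge to node `j` was present when the clock showed `c` -/
  present : Set (ℕ × ℝ)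
  /-- `(j, c, q)`: packet `q` arrived from node `j` when the clock showed `c` -/
  received : Set (ℕ × ℝ × Packet M)

/-- A deterministic distributed protocol, the same for all nodes and all networks: at each instant,
the view of the node determines which packet (if any) is sent now to each neighbour (given by its
identifier), and whether the node is in its terminal state. -/
structure Protocol where
  Msg : Type
  send : View Msg → ℕ → Option (Packet Msg)
  terminal : View Msg → Prop

/-- The circumstances in which a protocol is executed. The `source` is asked to broadcast item
`0, …, numRequests - 1` at the dates `request 0, …, request (numRequests - 1)`; node `v` starts at
date `start v`, not later than the first request. -/
structure Setting (V : Type) where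
  graph : TVG V
  ident : V → ℕ
  ident_injective : Function.Injective ident
  periodBound : ℝ
  source : V
  numRequests : ℕ
  numRequests_pos : 0 < numRequests
  request : ℕ → ℝ
  start : V → ℝ
  start_nonneg : ∀ v : V, 0 ≤ start v
  start_le : ∀ v : V, start v ≤ request 0

/-- `σ u v t` is the packet sent by `u` to `v` at date `t`, if any. -/
abbrev Traffic (V M : Type) := V → V → ℝ → Option (Packet M)

namespace Setting

variable {V M : Type}

/-- The packet `q`, sent by `u` to `v` at date `t`, is not lost; it arrives at `t + delay`. -/
def Delivered (S : Setting V) (σ : Traffic V M) (u v : V) (t : ℝ) (q : Packet M) : Prop :=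
  σ u v t = some q ∧ S.graph.Crossable u v t

/-- Item `k` is available at node `v` at date `t`: `v` is the source and the item was already
requested, or a packet with this item has arrived at `v`. -/
def Holds (S : Setting V) (σ : Traffic V M) (k : ℕ) (v : V) (t : ℝ) : Prop :=
  (v = S.source ∧ k < S.numRequests ∧ S.request k ≤ t) ∨
    ∃ (u : V) (s : ℝ) (q : Packet M),
      S.Delivered σ u v s q ∧ q.item = some k ∧ s + S.graph.delay ≤ t

/-- Item `k` is sent from `u` to `v` at date `t`. -/
def Emits (_S : Setting V) (σ : Traffic V M) (k : ℕ) (u v : V) (t : ℝ) : Prop :=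
  ∃ q : Packet M, σ u v t = some q ∧ q.item = some k

/-- What node `v` knows at date `t`. -/
def view (S : Setting V) (σ : Traffic V M) (v : V) (t : ℝ) : View M where
  ident := S.ident v
  delay := S.graph.delay
  periodBound := S.periodBound
  clock := t - S.start v
  requests := {kc | v = S.source ∧ kc.1 < S.numRequests ∧
    S.request kc.1 = S.start v + kc.2 ∧ S.start v + kc.2 ≤ t}
  present := {jc | 0 ≤ jc.2 ∧ S.start v + jc.2 ≤ t ∧
    ∃ w : V, S.ident w = jc.1 ∧ (S.graph.snapshot (S.start v + jc.2)).Adj v w}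
  received := {jcq | 0 ≤ jcq.2.1 ∧ S.start v + jcq.2.1 ≤ t ∧
    ∃ w : V, S.ident w = jcq.1 ∧
      S.Delivered σ w v (S.start v + jcq.2.1 - S.graph.delay) jcq.2.2}

/-- `t` belongs to the time devoted to item `k`: from its request up to the next request (if
any). -/
def Current (S : Setting V) (k : ℕ) (t : ℝ) : Prop :=
  S.request k ≤ t ∧ (k + 1 < S.numRequests → t < S.request (k + 1))

end Setting

namespace Protocol

variable {V : Type}

open Classical in
/-- What is sent by `u` to `v` at date `t` when the protocol is followed, if `σ` is the traffic
before `t`. Nothing is sent before a node starts, and an item that the sender does not hold is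
removed from the packet. -/
noncomputable def emission (A : Protocol) (S : Setting V) (σ : Traffic V A.Msg)
    (u v : V) (t : ℝ) : Option (Packet A.Msg) :=
  if S.start u ≤ t then
    (A.send (S.view σ u t) (S.ident v)).map
      fun q => { q with item := q.item.filter fun k => decide (S.Holds σ k u t) }
  else none

/-- `σ` is the traffic of an execution of the protocol. -/
def IsExecution (A : Protocol) (S : Setting V) (σ : Traffic V A.Msg) : Prop :=
  ∀ (u v : V) (t : ℝ), σ u v t = A.emission S σ u v t

theorem emission_congr (A : Protocol) (S : Setting V) (σ τ : Traffic V A.Msg) (t : ℝ)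
    (h : ∀ u v s, s + S.graph.delay ≤ t → σ u v s = τ u v s) (u v : V) :
    A.emission S σ u v t = A.emission S τ u v t := by
  have hH : ∀ k, S.Holds σ k u t = S.Holds τ k u t := by
    intro k
    refine propext (or_congr_right ?_)
    refine exists_congr fun w => exists_congr fun s => exists_congr fun q => ?_
    constructor
    · rintro ⟨⟨h1, h2⟩, h3, h4⟩
      exact ⟨⟨by rw [← h w u s h4]; exact h1, h2⟩, h3, h4⟩
    · rintro ⟨⟨h1, h2⟩, h3, h4⟩
      exact ⟨⟨by rw [h w u s h4]; exact h1, h2⟩, h3, h4⟩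
  have hV : S.view σ u t = S.view τ u t := by
    unfold Setting.view
    congr 1
    ext ⟨j, c, q⟩
    refine and_congr_right fun _ => and_congr_right fun h2 => ?_
    refine exists_congr fun w => and_congr_right fun _ => ?_
    have h2' : S.start u + c ≤ t := h2
    have := h w u (S.start u + c - S.graph.delay) (by linarith)
    simp only [Setting.Delivered, this]
  unfold emission
  rw [hV]
  congr! 6
  rw [hH]

/-- Every protocol has exactly one execution in every setting. -/
theorem existsUnique_isExecution (A : Protocol) (S : Setting V) :
    ∃! σ : Traffic V A.Msg, A.IsExecution S σ := by
  have hz := S.graph.delay_pos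
  have hneg : ∀ (σ : Traffic V A.Msg) (u v : V) (t : ℝ), t < 0 →
      A.emission S σ u v t = none := by
    intro σ u v t ht
    unfold emission
    rw [if_neg]
    have := S.start_nonneg u
    linarith
  -- two traffics that agree up to `c` are sent by the operator to traffics that agree further
  have hstep : ∀ (σ τ : Traffic V A.Msg) (n : ℕ),
      (∀ u v s, s < n * S.graph.delay → σ u v s = τ u v s) →
      ∀ u v s, s < (n + 1 : ℕ) * S.graph.delay →
        A.emission S σ u v s = A.emission S τ u v s := by
    intro σ τ n h u v s hs
    refine A.emission_congr S σ τ s (fun u' v' s' hs' => h u' v' s' ?_) u v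
    push_cast at hs
    linarith
  let it : ℕ → Traffic V A.Msg := fun n => (A.emission S)^[n] (fun _ _ _ => none)
  have hit : ∀ n, it (n + 1) = A.emission S (it n) := fun n =>
    Function.iterate_succ_apply' _ _ _
  have hsucc : ∀ (n : ℕ) u v s, s < n * S.graph.delay → it n u v s = it (n + 1) u v s := by
    intro n
    induction n with
    | zero =>
      intro u v s hs
      have hs' : s < 0 := by simpa using hs
      rw [hit, hneg _ _ _ _ hs']
      rfl
    | succ n ih =>
      intro u v s hs
      rw [hit, hit]
      exact hstep _ _ n ih u v s hs
  have hmono : ∀ (n m : ℕ) u v s, s < n * S.graph.delay → it n u v s = it (n + m) u v s := by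
    intro n m u v s hs
    induction m with
    | zero => rfl
    | succ m ih =>
      rw [ih]
      refine hsucc (n + m) u v s (hs.trans_le ?_)
      push_cast
      nlinarith [(Nat.cast_nonneg m : (0 : ℝ) ≤ m)]
  have hfl : ∀ s : ℝ, s < ((⌊s / S.graph.delay⌋₊ + 1 : ℕ) : ℝ) * S.graph.delay := by
    intro s
    rw [← div_lt_iff₀ hz]
    push_cast
    exact Nat.lt_floor_add_one _
  have hagree : ∀ (n : ℕ) u v s, s < n * S.graph.delay →
      it (⌊s / S.graph.delay⌋₊ + 1) u v s = it n u v s := by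
    intro n u v s hs
    rcases le_total n (⌊s / S.graph.delay⌋₊ + 1) with h | h
    · obtain ⟨m, hm⟩ := Nat.exists_eq_add_of_le h
      rw [hm]
      exact (hmono n m u v s hs).symm
    · obtain ⟨m, hm⟩ := Nat.exists_eq_add_of_le h
      rw [hm]
      exact hmono _ m u v s (hfl s)
  refine ⟨fun u v s => it (⌊s / S.graph.delay⌋₊ + 1) u v s, ?_, ?_⟩
  · intro u v t
    have h1 := hstep (fun u v s => it (⌊s / S.graph.delay⌋₊ + 1) u v s)
      (it (⌊t / S.graph.delay⌋₊ + 1)) (⌊t / S.graph.delay⌋₊ + 1)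
      (fun u v s hs => hagree _ u v s hs) u v t
      ((hfl t).trans_le (by push_cast; nlinarith))
    rw [h1, ← hit]
    exact hsucc _ u v t (hfl t)
  · intro τ hτ
    have key : ∀ (n : ℕ) u v s, s < n * S.graph.delay → τ u v s = it n u v s := by
      intro n
      induction n with
      | zero =>
        intro u v s hs
        have hs' : s < 0 := by simpa using hs
        rw [hτ u v s, hneg _ _ _ _ hs']
        rfl
      | succ n ih =>
        intro u v s hs
        rw [hτ u v s, hit]
        exact hstep _ _ n ih u v s hs
    funext u v s
    exact key _ u v s (hfl s)

/-- The traffic of the execution of the protocol. -/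
noncomputable def traffic (A : Protocol) (S : Setting V) : Traffic V A.Msg :=
  (A.existsUnique_isExecution S).choose

/-- The source is in its terminal state at date `t`. -/
def Terminal (A : Protocol) (S : Setting V) (t : ℝ) : Prop :=
  A.terminal (S.view (A.traffic S) S.source t)

/-- A request is made only when the previous broadcast has terminated at the source. -/
def RequestsInOrder (A : Protocol) (S : Setting V) : Prop :=
  ∀ k : ℕ, k + 1 < S.numRequests → ∃ t : ℝ, S.Current k t ∧ A.Terminal S t

/-- Only finitely many packets are sent in bounded time. -/
def FinitelyManySends (A : Protocol) (S : Setting V) : Prop :=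
  ∀ b : ℝ, {t : ℝ | t ≤ b ∧ ∃ u v : V, A.traffic S u v t ≠ none}.Finite

/-- Termination detection for item `k`: within finite time after the request the source enters the
terminal state; from then on, until the next request, it stays there and sends nothing; and when it
enters this state, all nodes have the item. -/
def DetectsTermination (A : Protocol) (S : Setting V) (k : ℕ) : Prop :=
  ∃ T : ℝ, S.Current k T ∧
    (∀ t : ℝ, S.Current k t → (A.Terminal S t ↔ T ≤ t)) ∧
    (∀ t : ℝ, S.Current k t → T ≤ t → ∀ v : V, A.traffic S S.source v t = none) ∧
    ∀ v : V, S.Holds (A.traffic S) k v T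

/-- `a` is the date at which node `v` gets item `k`. -/
def ReceptionDate (A : Protocol) (S : Setting V) (k : ℕ) (v : V) (a : ℝ) : Prop :=
  IsLeast {t : ℝ | S.Holds (A.traffic S) k v t} a

/-- The broadcast of item `k` is fastest: the time from the first emission `s` of the item (by any
node) to its last reception `b` is the minimum duration of a broadcast from the source, over all
dates of the lifetime. (If the source is the only node there is nothing to send.) -/
def IsFastest (A : Protocol) (S : Setting V) (k : ℕ) : Prop :=
  Nontrivial V → ∃ s b : ℝ, S.request k ≤ s ∧
    IsLeast {t : ℝ | ∃ u v : V, S.Emits (A.traffic S) k u v t} s ∧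
    IsGreatest {a : ℝ | ∃ v : V, v ≠ S.source ∧ A.ReceptionDate S k v a} b ∧
    IsLeast (S.graph.broadcastDurations S.source) (b - s)

/-- The broadcast of item `k` is a foremost broadcast from a date `s` of minimum temporal
eccentricity of the source: it starts at `s` or later, and every node gets the item at the earliest
date at which a journey from the source departing at `s` or later can arrive. -/
def IsForemostFromMinEccentricity (A : Protocol) (S : Setting V) (k : ℕ) : Prop :=
  ∃ s : ℝ, S.request k ≤ s ∧ S.graph.IsMinEccentricityDate S.source s ∧
    (∀ (u v : V) (t : ℝ), S.Emits (A.traffic S) k u v t → s ≤ t) ∧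
    ∀ v : V, v ≠ S.source → ∃ δ : ℝ,
      S.graph.IsTemporalDistance S.source s v δ ∧ A.ReceptionDate S k v (s + δ)

/-- All the broadcasts take place along one and the same tree: there is a spanning tree of the
footprint such that every item is sent only along edges of this tree. -/
def UsesOneTree (A : Protocol) (S : Setting V) : Prop :=
  ∃ T : SimpleGraph V, T ≤ S.graph.footprint ∧ T.IsTree ∧
    ∀ k : ℕ, k < S.numRequests → ∀ (u v : V) (t : ℝ),
      S.Emits (A.traffic S) k u v t → T.Adj u v

end Protocol

/-! A broadcast from the source `x` is encoded by a labelling `α` of the nodes with arrival dates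
(`TVG.IsArrival`). If moreover no crossing improves a label (`TVG.IsForemost`), then `α v - α x` is
the temporal distance to `v` at date `α x`. Presence sets are closed, hence so is the set of arrival
labellings. Compactness then yields foremost labellings from every date (`exists_isForemost`) and,
since periodicity confines the departures to one period, a labelling of minimum duration over the
lifetime (`exists_optimal`).

The distributed difficulty is to bring the whole schedule to the source. Let `P` be the known bound.
Each node records its incident edges for `2 * P` units of time. Any `q ≤ P` under which these
records are consistent is a genuine period of the reported edges (`Setting.adj_add_iff`), because
the true period, being at most `P`, moves every date into the first half of the record. Thus the
true period need not be identified. Reports are flooded at crossings that each sender predicts from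
its own record, and clock offsets are recovered from time stamps and the delay. Once the reports
held by the source are closed under neighbours, connectedness forces them to be all the reports
(`Setting.knowledge_eq_full`), so the source recognises completeness without knowing the number of
nodes.

From then on the knowledge of the source is constant, and so is the optimal plan chosen from it;
this gives a single tree for all items. The plan travels with the item, and a relay only needs the
time elapsed since reception. Termination is computed rather than acknowledged: start of the
broadcast plus planned duration. As requests wait for termination, broadcasts occupy disjoint time
intervals (`item_unique`). Nothing is sent off plan (`sendsItem`) and the plan is carried out
(`exists_delivered`), so the required properties are read off from the plan. Minimality of the
duration also forces an emission at the very start (`exists_arrival_eq_delay`), so that the measured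
duration is the planned one. -/

namespace TVG

variable {V : Type}

/-! ### Presence dates and crossings -/

theorem nonneg_of_adj (G : TVG V) {t : ℝ} {u v : V} (h : (G.snapshot t).Adj u v) : 0 ≤ t := by
  by_contra ht
  rw [G.snapshot_of_neg t (not_le.1 ht)] at h
  exact h

theorem Crossable.adj {G : TVG V} {u v : V} {t : ℝ} (h : G.Crossable u v t) :
    (G.snapshot t).Adj u v :=
  h t ⟨le_rfl, by linarith [G.delay_pos]⟩

theorem Crossable.nonneg {G : TVG V} {u v : V} {t : ℝ} (h : G.Crossable u v t) : 0 ≤ t :=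
  G.nonneg_of_adj h.adj

theorem Crossable.ne {G : TVG V} {u v : V} {t : ℝ} (h : G.Crossable u v t) : u ≠ v := h.adj.ne

/-- A union of disjoint closed intervals of length at least `z > 0` is closed. -/
theorem isClosed_of_disjoint_intervals {z : ℝ} (hz : 0 < z) {A : Set ℝ} {I : Set (Set ℝ)}
    (hdisj : I.PairwiseDisjoint id)
    (hI : ∀ J ∈ I, (∃ a b : ℝ, a + z ≤ b ∧ J = Set.Icc a b) ∨ (∃ a : ℝ, J = Set.Ici a))
    (hU : ⋃₀ I = A) : IsClosed A := by
  subst hU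
  have heq : ∀ J ∈ I, ∀ J' ∈ I, ∀ y, y ∈ J → y ∈ J' → J = J' := by
    intro J hJ J' hJ' y h1 h2
    by_contra hne
    exact Set.disjoint_left.1 (hdisj hJ hJ' hne) h1 h2
  -- If an interval meets the points within `z` to the right of `y`, let `a` be its left end.
  -- Another interval meeting the gap between `y` and `a` would start after `y` and, having length
  -- at least `z`, would contain `a`, against disjointness.
  have hright : ∀ y, y ∉ ⋃₀ I → ∃ e > 0, ∀ w, y < w → w < y + e → w ∉ ⋃₀ I := by
    intro y hy
    by_cases h : ∃ w, y < w ∧ w < y + z ∧ w ∈ ⋃₀ I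
    · obtain ⟨w, hyw, hwz, J, hJ, hwJ⟩ := h
      have hyJ : y ∉ J := fun h => hy ⟨J, hJ, h⟩
      obtain ⟨a, hya, hiv, haz⟩ : ∃ a, y < a ∧ (∀ r, a ≤ r → r ≤ a + z → r ∈ J) ∧
          (∀ r ∈ J, a ≤ r) := by
        rcases hI J hJ with ⟨a, b, hab, rfl⟩ | ⟨a, rfl⟩
        · refine ⟨a, ?_, fun r h1 h2 => ⟨h1, by linarith⟩, fun r h => h.1⟩
          by_contra hc
          exact hyJ ⟨not_lt.1 hc, hyw.le.trans hwJ.2⟩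
        · refine ⟨a, ?_, fun r h1 h2 => h1, fun r h => h⟩
          by_contra hc
          exact hyJ (not_lt.1 hc)
      have haw := haz w hwJ
      refine ⟨a - y, by linarith, ?_⟩
      rintro r h1 h2 ⟨J', hJ', hr⟩
      have hyJ' : y ∉ J' := fun h => hy ⟨J', hJ', h⟩
      have haJ' : a ∈ J' := by
        rcases hI J' hJ' with ⟨a', b', hab, rfl⟩ | ⟨a', rfl⟩
        · have : y < a' := by
            by_contra hc
            exact hyJ' ⟨not_lt.1 hc, h1.le.trans hr.2⟩
          exact ⟨by linarith [hr.1], by linarith⟩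
        · exact le_trans (Set.mem_Ici.1 hr) (by linarith)
      have := heq J hJ J' hJ' a (hiv a le_rfl (by linarith)) haJ'
      subst this
      linarith [haz r hr]
    · push Not at h
      exact ⟨z, hz, h⟩
  have hleft : ∀ y, y ∉ ⋃₀ I → ∃ e > 0, ∀ w, y - e < w → w < y → w ∉ ⋃₀ I := by
    intro y hy
    by_cases h : ∃ w, y - z < w ∧ w < y ∧ w ∈ ⋃₀ I
    · obtain ⟨w, hyw, hwz, J, hJ, hwJ⟩ := h
      have hyJ : y ∉ J := fun h => hy ⟨J, hJ, h⟩
      obtain ⟨b, hya, hiv, haz⟩ : ∃ b, b < y ∧ (∀ r, b - z ≤ r → r ≤ b → r ∈ J) ∧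
          (∀ r ∈ J, r ≤ b) := by
        rcases hI J hJ with ⟨a, b, hab, rfl⟩ | ⟨a, rfl⟩
        · refine ⟨b, ?_, fun r h1 h2 => ⟨by linarith, h2⟩, fun r h => h.2⟩
          by_contra hc
          exact hyJ ⟨hwJ.1.trans hwz.le, not_lt.1 hc⟩
        · exact absurd (le_trans (Set.mem_Ici.1 hwJ) hwz.le) hyJ
      have haw := haz w hwJ
      refine ⟨y - b, by linarith, ?_⟩
      rintro r h1 h2 ⟨J', hJ', hr⟩
      have hyJ' : y ∉ J' := fun h => hy ⟨J', hJ', h⟩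
      have haJ' : b ∈ J' := by
        rcases hI J' hJ' with ⟨a', b', hab, rfl⟩ | ⟨a', rfl⟩
        · have : b' < y := by
            by_contra hc
            exact hyJ' ⟨hr.1.trans h2.le, not_lt.1 hc⟩
          exact ⟨by linarith, by linarith [hr.2]⟩
        · exact absurd (le_trans (Set.mem_Ici.1 hr) h2.le) hyJ'
      have := heq J hJ J' hJ' b (hiv b (by linarith) le_rfl) haJ'
      subst this
      linarith [haz r hr]
    · push Not at h
      exact ⟨z, hz, h⟩
  rw [← isOpen_compl_iff, Metric.isOpen_iff]
  intro y hy
  obtain ⟨e, he, h1⟩ := hright y hy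
  obtain ⟨e', he', h2⟩ := hleft y hy
  refine ⟨min e e', lt_min he he', fun w hw => ?_⟩
  rw [Metric.mem_ball, Real.dist_eq, abs_lt] at hw
  have m1 := min_le_left e e'
  have m2 := min_le_right e e'
  rcases lt_trichotomy w y with h | h | h
  · exact h2 w (by linarith) h
  · exact h ▸ hy
  · exact h1 w h (by linarith)

theorem isClosed_adj (G : TVG V) (u v : V) : IsClosed {t : ℝ | (G.snapshot t).Adj u v} := by
  obtain ⟨I, h1, h2, h3⟩ := G.presence_intervals u v
  exact isClosed_of_disjoint_intervals G.delay_pos h1 h2 h3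

theorem isClosed_crossable (G : TVG V) (u v : V) : IsClosed {t : ℝ | G.Crossable u v t} := by
  have h : {t : ℝ | G.Crossable u v t} =
      ⋂ h ∈ Set.Icc 0 G.delay, (fun t : ℝ => t + h) ⁻¹' {t : ℝ | (G.snapshot t).Adj u v} := by
    ext t
    simp only [Set.mem_ofPred_eq, Crossable, Set.mem_iInter, Set.mem_preimage]
    constructor
    · intro H h hh
      exact H _ ⟨by linarith [hh.1], by linarith [hh.2]⟩
    · intro H t' ht'
      have := H (t' - t) ⟨by linarith [ht'.1], by linarith [ht'.2]⟩
      rwa [add_sub_cancel] at this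
  rw [h]
  exact isClosed_biInter fun h _ => (G.isClosed_adj u v).preimage (by fun_prop)

/-- Intervals of presence last at least the delay, so a crossing can start at the left end of one.
-/
theorem exists_crossable_of_footprint (G : TVG V) {u v : V} (h : G.footprint.Adj u v) :
    ∃ t, G.Crossable u v t := by
  obtain ⟨t, ht⟩ := h
  obtain ⟨I, h1, h2, h3⟩ := G.presence_intervals u v
  have hmem : ∀ J ∈ I, ∀ r ∈ J, (G.snapshot r).Adj u v := by
    intro J hJ r hr
    have : r ∈ ⋃₀ I := ⟨J, hJ, hr⟩
    rwa [h3] at this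
  have : t ∈ ⋃₀ I := by rw [h3]; exact ht
  obtain ⟨J, hJ, htJ⟩ := this
  rcases h2 J hJ with ⟨a, b, hab, rfl⟩ | ⟨a, rfl⟩
  · exact ⟨a, fun r hr => hmem _ hJ r ⟨hr.1, hr.2.trans hab⟩⟩
  · exact ⟨a, fun r hr => hmem _ hJ r hr.1⟩

/-! ### Periodicity -/

theorem IsPeriodic.snapshot_add {G : TVG V} {p : ℝ} (hp : G.IsPeriodic p) {t : ℝ} (m : ℤ)
    (ht : 0 ≤ t) (ht' : 0 ≤ t + m * p) : G.snapshot (t + m * p) = G.snapshot t := by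
  rcases lt_trichotomy m 0 with h | h | h
  · obtain ⟨k, hk⟩ := Int.eq_ofNat_of_zero_le (neg_nonneg.2 h.le)
    have hk' : (m : ℝ) = -(k : ℝ) := by
      have : m = -(k : ℤ) := by omega
      rw [this]; push_cast; ring
    have := hp.2 (t + m * p) ht' k (by omega)
    rw [this, hk']
    congr 1
    ring
  · simp [h]
  · obtain ⟨k, hk⟩ := Int.eq_ofNat_of_zero_le h.le
    have := hp.2 t ht k (by omega)
    rw [this, hk]
    simp

theorem IsPeriodic.crossable_add {G : TVG V} {p : ℝ} (hp : G.IsPeriodic p) {t : ℝ} (m : ℤ)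
    {u v : V} (h : G.Crossable u v t) (ht' : 0 ≤ t + m * p) : G.Crossable u v (t + m * p) := by
  intro r hr
  have h1 := h (r - m * p) ⟨by linarith [hr.1], by linarith [hr.2]⟩
  have h2 := hp.snapshot_add m (G.nonneg_of_adj h1) (by linarith [hr.1])
  rw [sub_add_cancel] at h2
  rwa [h2]

theorem isPeriodic_of_one {G : TVG V} {p : ℝ} (hp : 0 < p)
    (h : ∀ t, 0 ≤ t → G.snapshot t = G.snapshot (t + p)) : G.IsPeriodic p := by
  refine ⟨hp, fun t ht k _ => ?_⟩
  induction k with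
  | zero => simp
  | succ k ih =>
    rcases Nat.eq_zero_or_pos k with rfl | hk
    · simpa using h t ht
    · rw [ih hk, h _ (by positivity)]
      congr 1
      push_cast
      ring

theorem exists_int_shift {p : ℝ} (hp : 0 < p) (t r : ℝ) :
    ∃ m : ℤ, r ≤ t + m * p ∧ t + m * p < r + p := by
  obtain ⟨m, hm, -⟩ := existsUnique_add_zsmul_mem_Ico hp t r
  refine ⟨m, ?_⟩
  simpa using hm

theorem exists_nat_shift {p : ℝ} (hp : 0 < p) (t r : ℝ) : ∃ m : ℕ, r ≤ t + m * p := by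
  obtain ⟨m, hm⟩ := exists_nat_ge ((r - t) / p)
  refine ⟨m, ?_⟩
  rw [div_le_iff₀ hp] at hm
  linarith

theorem IsPeriodic.exists_crossable_mem {G : TVG V} {p : ℝ} (hp : G.IsPeriodic p) {u v : V}
    (h : G.footprint.Adj u v) {r : ℝ} (hr : 0 ≤ r) :
    ∃ t, G.Crossable u v t ∧ r ≤ t ∧ t ≤ r + p := by
  obtain ⟨t, ht⟩ := G.exists_crossable_of_footprint h
  obtain ⟨m, h1, h2⟩ := exists_int_shift hp.1 t r
  exact ⟨_, hp.crossable_add m ht (hr.trans h1), h1, h2.le⟩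

/-! ### Arrival labellings -/

/-- `α` assigns arrival dates to the nodes: every node other than `x` is reached by crossing an edge
from a node that was reached before. -/
def IsArrival (G : TVG V) (x : V) (α : V → ℝ) : Prop :=
  ∀ v, v ≠ x → ∃ u, α u + G.delay ≤ α v ∧ G.Crossable u v (α v - G.delay)

/-- No crossing reaches a node before the date assigned to it. -/
def IsForemost (G : TVG V) (α : V → ℝ) : Prop :=
  ∀ u v t, α u ≤ t → G.Crossable u v t → α v ≤ t + G.delay

section

variable {G : TVG V} {x : V} {α β : V → ℝ}

theorem label_induction [Finite V] (α : V → ℝ) {P : V → Prop}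
    (h : ∀ v, (∀ u, α u < α v → P u) → P v) (v : V) : P v := by
  have hwf : WellFounded fun u v : V => α u < α v :=
    @Finite.wellFounded_of_trans_of_irrefl V _ _ ⟨fun _ _ _ => lt_trans⟩ ⟨fun _ => lt_irrefl _⟩
  exact hwf.induction v h

theorem IsArrival.source_le [Finite V] (hα : G.IsArrival x α) (v : V) : α x ≤ α v := by
  induction v using label_induction α with | h v ih => ?_
  by_cases hv : v = x
  · rw [hv]
  · obtain ⟨u, hu, -⟩ := hα v hv
    have := G.delay_pos
    linarith [ih u (by linarith)]

theorem IsArrival.source_add_delay_le [Finite V] (hα : G.IsArrival x α) {v : V} (hv : v ≠ x) :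
    α x + G.delay ≤ α v := by
  obtain ⟨u, hu, -⟩ := hα v hv
  linarith [hα.source_le u]

/-- Induction along `β`: the crossing by which `β` reaches `v` is also available to `α`, which has
reached the parent no later. -/
theorem IsForemost.le_arrival [Finite V] (hα : G.IsForemost α) (hβ : G.IsArrival x β) (hx : α x ≤ β x)
    (v : V) : α v ≤ β v := by
  induction v using label_induction β with | h v ih => ?_
  by_cases hv : v = x
  · rwa [hv]
  · obtain ⟨u, hu, hc⟩ := hβ v hv
    have := G.delay_pos
    have := hα u v _ (by linarith [ih u (by linarith)]) hc
    linarith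

theorem IsArrival.shift [Finite V] {p : ℝ} (hp : G.IsPeriodic p) (hα : G.IsArrival x α) (m : ℤ)
    (h0 : 0 ≤ α x + m * p) : G.IsArrival x fun v => α v + m * p := by
  intro v hv
  obtain ⟨u, hu, hc⟩ := hα v hv
  refine ⟨u, by linarith, ?_⟩
  have := hp.crossable_add m hc (by linarith [hα.source_le u])
  convert this using 1
  ring

/-- Crossings are shifted back to compare them with `α`; nonnegative labels keep the shifted dates
inside the lifetime, where periodicity applies. -/
theorem IsForemost.shift {p : ℝ} (hp : G.IsPeriodic p) (hα : G.IsForemost α) (m : ℤ)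
    (h0 : ∀ v, 0 ≤ α v) : G.IsForemost fun v => α v + m * p := by
  intro u v t hu hc
  have := hp.crossable_add (-m) hc (by push_cast; linarith [h0 u])
  have := hα u v _ (by push_cast; linarith) this
  push_cast at this
  linarith

theorem IsForemost.le_of_journey (hα : G.IsForemost α) {u v : V} {d a : ℝ}
    (h : G.Journey u v d a) (hd : α u ≤ d) : α v ≤ a := by
  induction h with
  | single h => exact hα _ _ _ hd h
  | extend h hat hc ih => exact hα _ _ _ ((ih hd).trans hat) hc

theorem IsArrival.exists_journey [Finite V] (hα : G.IsArrival x α) (v : V) (hv : v ≠ x) :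
    ∃ d, α x ≤ d ∧ G.Journey x v d (α v) := by
  induction v using label_induction α with | h v ih => ?_
  obtain ⟨u, hu, hc⟩ := hα v hv
  have hd := G.delay_pos
  by_cases hux : u = x
  · subst hux
    refine ⟨α v - G.delay, by linarith, ?_⟩
    have := Journey.single hc
    rwa [sub_add_cancel] at this
  · obtain ⟨d, h1, h2⟩ := ih u (by linarith) hux
    refine ⟨d, h1, ?_⟩
    have := Journey.extend h2 (by linarith) hc
    rwa [sub_add_cancel] at this

/-- Following parents back to `x` gives a journey that attains the label, and foremostness bounds
every journey from below, one crossing at a time. -/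
theorem IsArrival.isTemporalDistance [Finite V] (hα : G.IsArrival x α) (hf : G.IsForemost α) (v : V) :
    G.IsTemporalDistance x (α x) v (α v - α x) := by
  by_cases hv : v = x
  · left
    simp [hv]
  · right
    refine ⟨fun h => hv h.symm, ?_, ?_⟩
    · obtain ⟨d, h1, h2⟩ := hα.exists_journey v hv
      exact ⟨d, h1, by rwa [add_sub_cancel]⟩
    · rintro a ⟨d, h1, h2⟩
      rw [add_sub_cancel]
      exact hf.le_of_journey h2 h1

theorem IsTemporalDistance.unique {t δ δ' : ℝ} {v : V} (h : G.IsTemporalDistance x t v δ)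
    (h' : G.IsTemporalDistance x t v δ') : δ = δ' := by
  rcases h with ⟨h1, h2⟩ | ⟨h1, h2⟩ <;> rcases h' with ⟨h3, h4⟩ | ⟨h3, h4⟩
  · rw [h2, h4]
  · exact absurd h1 h3
  · exact absurd h3 h1
  · have := h2.unique h4
    linarith

theorem IsArrival.isTemporalEccentricity [Finite V] (hα : G.IsArrival x α) (hf : G.IsForemost α) {ε : ℝ}
    (hle : ∀ v, α v - α x ≤ ε) (hex : ∃ v, α v - α x = ε) :
    G.IsTemporalEccentricity x (α x) ε := by
  refine ⟨fun v => ⟨_, hα.isTemporalDistance hf v⟩, ?_, ?_⟩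
  · obtain ⟨v, hv⟩ := hex
    exact ⟨v, hv ▸ hα.isTemporalDistance hf v⟩
  · rintro δ ⟨v, hv⟩
    rw [hv.unique (hα.isTemporalDistance hf v)]
    exact hle v

/-! ### Existence of foremost labellings -/

/-- Follow a breadth-first tree of the footprint: each hop waits at most `p` for a crossing and
takes one delay, so a budget of `p + G.delay` per level suffices. -/
theorem exists_isArrival {p : ℝ} (hp : G.IsPeriodic p) (hconn : G.footprint.Connected) (x : V)
    {s : ℝ} (hs : 0 ≤ s) : ∃ α, G.IsArrival x α ∧ α x = s := by
  classical
  have hd := G.delay_pos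
  have hpp := hp.1
  have hpar : ∀ v, v ≠ x → ∃ u, G.footprint.Adj u v ∧
      G.footprint.dist u x + 1 ≤ G.footprint.dist v x := by
    intro v hv
    obtain ⟨w, hw⟩ := hconn.exists_walk_length_eq_dist v x
    cases w with
    | nil => exact absurd rfl hv
    | cons h w' =>
      refine ⟨_, h.symm, ?_⟩
      rw [← hw, SimpleGraph.Walk.length_cons]
      exact Nat.succ_le_succ (SimpleGraph.dist_le w')
  choose! par hadj hdist using hpar
  have hcr : ∀ v, v ≠ x → ∃ t, G.Crossable (par v) v t ∧
      s + G.footprint.dist (par v) x * (p + G.delay) ≤ t ∧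
      t ≤ s + G.footprint.dist (par v) x * (p + G.delay) + p := fun v hv =>
    hp.exists_crossable_mem (hadj v hv) (by positivity)
  choose! τ h1 h2 h3 using hcr
  let α : V → ℝ := fun v => if v = x then s else τ v + G.delay
  have hα : ∀ v, α v ≤ s + G.footprint.dist v x * (p + G.delay) := by
    intro v
    by_cases hv : v = x
    · simp [α, hv]
    · simp only [α, hv, if_false]
      have : (G.footprint.dist (par v) x : ℝ) + 1 ≤ G.footprint.dist v x := by
        exact_mod_cast hdist v hv
      have h4 := mul_le_mul_of_nonneg_right this (by linarith : 0 ≤ p + G.delay)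
      linarith [h3 v hv]
  refine ⟨α, fun v hv => ⟨par v, ?_, ?_⟩, by simp [α]⟩
  · have : α v = τ v + G.delay := by simp [α, hv]
    linarith [hα (par v), h2 v hv]
  · have : α v = τ v + G.delay := by simp [α, hv]
    rw [this, add_sub_cancel_right]
    exact h1 v hv

/-- The parent of a node may vary with the labelling, but it ranges over a finite set, so the union
over parents stays closed. -/
theorem isClosed_isArrival [Finite V] (G : TVG V) (x : V) : IsClosed {α : V → ℝ | G.IsArrival x α} := by
  have : {α : V → ℝ | G.IsArrival x α} = ⋂ v, ⋂ (_ : v ≠ x), ⋃ u,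
      ({α : V → ℝ | α u + G.delay ≤ α v} ∩
        (fun α : V → ℝ => α v - G.delay) ⁻¹' {t : ℝ | G.Crossable u v t}) := by
    ext α
    simp [IsArrival]
  rw [this]
  refine isClosed_iInter fun v => isClosed_iInter fun _ => isClosed_iUnion_of_finite fun u => ?_
  exact (isClosed_le (by fun_prop) (by fun_prop)).inter
    ((G.isClosed_crossable u v).preimage (by fun_prop))

/-- Minimise the sum of the labels over a compact set of arrival labellings with fixed departure. A
crossing that beats a label would allow this label alone to be lowered: the other nodes keep their
parents, and the sum decreases. -/
theorem exists_isForemost [Finite V] {p : ℝ} (hp : G.IsPeriodic p) (hconn : G.footprint.Connected) (x : V)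
    {s : ℝ} (hs : 0 ≤ s) : ∃ α, G.IsArrival x α ∧ G.IsForemost α ∧ α x = s := by
  classical
  have := Fintype.ofFinite V
  obtain ⟨α₀, h0, h0s⟩ := exists_isArrival hp hconn x hs
  let F : Set (V → ℝ) := {α | G.IsArrival x α} ∩ Set.Icc (fun _ => s) α₀ ∩ {α | α x = s}
  have hF : IsCompact F := by
    have h1 : IsCompact ({α | G.IsArrival x α} ∩ Set.Icc (fun _ => s) α₀) :=
      isCompact_Icc.inter_left (G.isClosed_isArrival x)
    exact h1.inter_right (isClosed_eq (by fun_prop) (by fun_prop))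
  obtain ⟨α, ⟨⟨h1, h2⟩, h3⟩, hmin⟩ := hF.exists_isMinOn
    ⟨α₀, ⟨h0, fun v => h0s ▸ h0.source_le v, le_rfl⟩, h0s⟩
    (f := fun α => ∑ v, α v) (by fun_prop)
  have h3' : α x = s := h3
  refine ⟨α, h1, fun u v t hu hc => ?_, h3⟩
  by_contra hlt
  push Not at hlt
  have hd := G.delay_pos
  have hux := h1.source_le u
  have hvx : v ≠ x := by
    rintro rfl
    linarith
  have hle : Function.update α v (t + G.delay) ≤ α := by
    intro w
    by_cases hw : w = v
    · subst hw
      simpa using hlt.le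
    · simp [hw]
  have hmem : Function.update α v (t + G.delay) ∈ F := by
    refine ⟨⟨?_, ?_, hle.trans h2.2⟩, ?_⟩
    · intro w hw
      by_cases hwv : w = v
      · subst hwv
        refine ⟨u, ?_, ?_⟩
        · rw [Function.update_of_ne hc.ne, Function.update_self]
          linarith
        · rw [Function.update_self, add_sub_cancel_right]
          exact hc
      · obtain ⟨u', h4, h5⟩ := h1 w hw
        refine ⟨u', ?_, ?_⟩
        · rw [Function.update_of_ne hwv]
          linarith [hle u']
        · rwa [Function.update_of_ne hwv]
    · intro w
      by_cases hw : w = v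
      · subst hw
        rw [Function.update_self]
        linarith
      · rw [Function.update_of_ne hw]
        exact h2.1 w
    · change Function.update α v (t + G.delay) x = s
      rw [Function.update_of_ne (Ne.symm hvx), h3']
  have hge : ∑ w, α w ≤ ∑ w, Function.update α v (t + G.delay) w := hmin hmem
  have : ∑ w, Function.update α v (t + G.delay) w < ∑ w, α w :=
    Finset.sum_lt_sum (fun w _ => hle w) ⟨v, Finset.mem_univ _, by simpa using hlt⟩
  linarith

/-- From every date `r` on, there is a foremost labelling whose duration is minimum over the
lifetime. -/
theorem exists_optimal [Finite V] {p : ℝ} (hp : G.IsPeriodic p) (hconn : G.footprint.Connected) (x : V)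
    (r : ℝ) : ∃ α, r ≤ α x ∧ 0 ≤ α x ∧ G.IsArrival x α ∧ G.IsForemost α ∧
      ∀ β, 0 ≤ β x → G.IsArrival x β → ∃ w, ∀ v, α v - α x ≤ β w - β x := by
  classical
  have := Fintype.ofFinite V
  have hpp := hp.1
  have : Nonempty V := ⟨x⟩
  obtain ⟨α₀, h0, h0s⟩ := exists_isArrival hp hconn x le_rfl
  -- The labels of an arrival labelling are at least the one of `x`, so on these this norm is the
  -- duration.
  let f : (V → ℝ) → ℝ := fun α => ‖fun v => α v - α x‖
  have hle : ∀ (α : V → ℝ) v, α v - α x ≤ f α := fun α v =>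
    (le_abs_self _).trans (norm_le_pi_norm (fun v => α v - α x) v)
  have hex : ∀ α : V → ℝ, G.IsArrival x α → ∃ w, f α ≤ α w - α x := by
    intro α hα
    obtain ⟨w, hw⟩ := Finite.exists_max fun v => α v - α x
    refine ⟨w, (pi_norm_le_iff_of_nonneg (sub_nonneg.2 (hα.source_le w))).2 fun v => ?_⟩
    rw [Real.norm_eq_abs, abs_of_nonneg (sub_nonneg.2 (hα.source_le v))]
    exact hw v
  let F : Set (V → ℝ) := {α | G.IsArrival x α} ∩
    Set.Icc (fun _ => 0) (fun _ => p + f α₀) ∩ {α | α x ≤ p}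
  have hF : IsCompact F := by
    have h1 : IsCompact ({α | G.IsArrival x α} ∩ Set.Icc (fun _ => 0) (fun _ => p + f α₀)) :=
      isCompact_Icc.inter_left (G.isClosed_isArrival x)
    exact h1.inter_right (isClosed_le (by fun_prop) (by fun_prop))
  have h0mem : α₀ ∈ F := by
    refine ⟨⟨h0, fun v => h0s ▸ h0.source_le v, fun v => ?_⟩, ?_⟩
    · have := hle α₀ v
      rw [h0s] at this
      change α₀ v ≤ p + f α₀
      linarith
    · change α₀ x ≤ p
      linarith
  obtain ⟨α, ⟨⟨h1, h2⟩, h3⟩, hmin⟩ := hF.exists_isMinOn ⟨α₀, h0mem⟩ (f := f) (by fun_prop)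
  have hbest : ∀ β, 0 ≤ β x → G.IsArrival x β → f α ≤ f β := by
    intro β hβ0 hβ
    -- The cap `p + f α₀` makes `F` compact. A labelling no better than `α₀` need not lie in `F`; a
    -- better one does, once shifted to depart in `[0, p)`.
    by_cases hcmp : f α₀ ≤ f β
    · exact le_trans (hmin h0mem) hcmp
    · push Not at hcmp
      obtain ⟨m, hm1, hm2⟩ := exists_int_shift hpp (β x) 0
      have hβ' := hβ.shift hp m hm1
      have hfeq : f (fun v => β v + m * p) = f β := by
        simp only [f, add_sub_add_right_eq_sub]
      rw [← hfeq]
      refine hmin ⟨⟨hβ', fun v => hm1.trans (hβ'.source_le v), fun v => ?_⟩, ?_⟩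
      · have := hle β v
        change β v + m * p ≤ p + f α₀
        linarith
      · change β x + m * p ≤ p
        linarith
  obtain ⟨m, hm⟩ := exists_nat_shift hpp (α x) r
  have hαx : 0 ≤ α x := h2.1 x
  have hmp : 0 ≤ (m : ℝ) * p := by positivity
  -- A minimiser of the duration may be late at nodes that do not determine the maximum. The
  -- foremost labelling with the same (shifted) departure lies below it everywhere.
  obtain ⟨γ, hγ1, hγ2, hγ3⟩ := exists_isForemost hp hconn x (s := α x + m * p) (by linarith)
  have hα' := h1.shift hp (m : ℤ) (by push_cast; linarith)
  refine ⟨γ, by linarith, by linarith, hγ1, hγ2, fun β hβ0 hβ => ?_⟩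
  obtain ⟨w, hw⟩ := hex β hβ
  refine ⟨w, fun v => ?_⟩
  have := hγ2.le_arrival hα' (by push_cast; linarith) v
  push_cast at this
  linarith [hle α v, hbest β hβ0 hβ]

end

end TVG

/-! ### Knowledge of the network -/

/-- What a node tells about node `i`: `(i, o, W)` where `o` shows the start of node `i` on the clock
of the teller, and `(j, c) ∈ W` if the edge from `i` to `j` was present at time `c` on the clock
of `i`, for all `c` up to twice the period bound. -/
abbrev Report := ℕ × ℝ × Set (ℕ × ℝ)

/-- Who receives the item from whom, and how long after the start of the broadcast. -/
structure Plan where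
  parent : ℕ → Option ℕ
  arrival : ℕ → ℝ

/-- A plan, a date (on the clock of the source) from which it can be executed, and its duration. -/
structure Scheme extends Plan where
  base : ℝ
  duration : ℝ

/-- The control content of the packets. -/
structure Note where
  clock : ℝ
  know : Set Report
  plan : Plan

instance : Inhabited Plan := ⟨⟨fun _ => none, fun _ => 0⟩⟩

instance : Inhabited Scheme := ⟨⟨default, 0, 0⟩⟩

/-- `q ≤ P` is compatible with all the reports over windows of length `2 * P`. -/
def IsWindowPeriod (P : ℝ) (K : Set Report) (q : ℝ) : Prop :=
  0 < q ∧ q ≤ P ∧ ∀ r ∈ K, ∀ (j : ℕ) (c : ℝ), 0 ≤ c → c ≤ P →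
    ((j, c) ∈ r.2.2 ↔ (j, c + q) ∈ r.2.2)

/-- The choice depends on the reports only, so the same knowledge gives the same period at all
times. -/
noncomputable def windowPeriod (P : ℝ) (K : Set Report) : ℝ :=
  Classical.epsilon (IsWindowPeriod P K)

/-- The presence of the edge to `j` at time `c`, as predicted from the window `W` and the
period `q`. -/
def Predicted (P q : ℝ) (W : Set (ℕ × ℝ)) (j : ℕ) (c : ℝ) : Prop :=
  ∃ n : ℤ, 0 ≤ c + n * q ∧ c + n * q ≤ P ∧ (j, c + n * q) ∈ W

def PredictedCrossing (P z q : ℝ) (W : Set (ℕ × ℝ)) (j : ℕ) (c : ℝ) : Prop :=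
  ∀ c' ∈ Set.Icc c (c + z), Predicted P q W j c'

/-- The edge from `i` to `j` can be crossed at time `c`, according to the reports in `K`. -/
def KnownCrossing (P z q : ℝ) (K : Set Report) (i j : ℕ) (c : ℝ) : Prop :=
  0 ≤ c ∧ ∃ o W, (i, o, W) ∈ K ∧ PredictedCrossing P z q W j (c - o)

/-- The nodes about which there is a report. -/
def reported (K : Set Report) : Set ℕ := {i | ∃ r ∈ K, r.1 = i}

/-- There is a report about node `x` and about all neighbours of the nodes in the reports. -/
def ReportsComplete (x : ℕ) (K : Set Report) : Prop :=
  x ∈ reported K ∧ ∀ r ∈ K, ∀ jc ∈ r.2.2, jc.1 ∈ reported K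

/-- The scheme describes a foremost broadcast tree from `x` with minimum duration, according to
the reports in `K`. -/
structure IsGoodScheme (P z : ℝ) (x : ℕ) (K : Set Report) (s : Scheme) : Prop where
  base_nonneg : 0 ≤ s.base
  parent_source : s.parent x = none
  arrival_source : s.arrival x = 0
  exists_parent : ∀ j ∈ reported K, j ≠ x → ∃ i ∈ reported K, s.parent j = some i ∧
    s.arrival i + z ≤ s.arrival j ∧
    KnownCrossing P z (windowPeriod P K) K i j (s.base + s.arrival j - z)
  foremost : ∀ i ∈ reported K, ∀ j ∈ reported K, ∀ t, s.base + s.arrival i ≤ t →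
    KnownCrossing P z (windowPeriod P K) K i j t → s.base + s.arrival j ≤ t + z
  optimal : ∀ β : ℕ → ℝ, 0 ≤ β x →
    (∀ j ∈ reported K, j ≠ x → ∃ i ∈ reported K, β i + z ≤ β j ∧
      KnownCrossing P z (windowPeriod P K) K i j (β j - z)) →
    ∃ w ∈ reported K, s.duration ≤ β w - β x
  arrival_le : ∀ j ∈ reported K, s.arrival j ≤ s.duration
  exists_arrival_eq : ∃ j ∈ reported K, s.arrival j = s.duration

/-- Time does not enter the choice: constant knowledge yields one scheme, hence one tree, for all
broadcasts. -/
noncomputable def goodScheme (P z : ℝ) (x : ℕ) (K : Set Report) : Scheme :=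
  Classical.epsilon (IsGoodScheme P z x K)

/-- According to the report `r` of a node on itself, the edge to `j` can be crossed at time `c.1`
and, with period `c.2`, at later times. -/
def IsSlot (P z : ℝ) (r : Report) (j : ℕ) (c : ℝ × ℝ) : Prop :=
  0 ≤ c.1 ∧ IsWindowPeriod P {r} c.2 ∧ PredictedCrossing P z c.2 r.2.2 j c.1

noncomputable def slot (P z : ℝ) (r : Report) (j : ℕ) : ℝ × ℝ :=
  Classical.epsilon (IsSlot P z r j)

/-! ### The protocol -/

namespace View

variable (vw : View Note)

/-- The truncation makes the report final once the clock has reached twice the bound; the offset of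
a node from itself is `0`. -/
def ownReport : Report := (vw.ident, 0, {jc ∈ vw.present | jc.2 ≤ 2 * vw.periodBound})

/-- The reports that the node has at time `c`. -/
def know (c : ℝ) : Set Report :=
  {r | (2 * vw.periodBound ≤ c ∧ r = vw.ownReport) ∨
    ∃ (j : ℕ) (c' : ℝ) (q : Packet Note) (r' : Report), (j, c', q) ∈ vw.received ∧ c' ≤ c ∧
      r' ∈ q.content.know ∧ r = (r'.1, r'.2.1 + (c' - vw.delay - q.content.clock), r'.2.2)}

noncomputable def cycle : ℝ := windowPeriod vw.periodBound (vw.know vw.clock)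

noncomputable def scheme : Scheme :=
  goodScheme vw.periodBound vw.delay vw.ident (vw.know vw.clock)

/-- The broadcast requested at time `c` can be executed in the `m`-th cycle. -/
def Ready (c : ℝ) (m : ℕ) : Prop :=
  c ≤ vw.scheme.base + m * vw.cycle ∧
    ReportsComplete vw.ident (vw.know (vw.scheme.base + m * vw.cycle))

/-- The broadcast requested at time `c` has started at time `b`. -/
def IsBase (c b : ℝ) : Prop :=
  ∃ m : ℕ, b = vw.scheme.base + m * vw.cycle ∧ vw.Ready c m ∧ (∀ m' < m, ¬ vw.Ready c m') ∧
    b ≤ vw.clock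

def IsLatest (k : ℕ) (c : ℝ) : Prop :=
  (k, c) ∈ vw.requests ∧ ∀ k' c', (k', c') ∈ vw.requests → k' ≤ k

/-- Item `k` has to be sent now to node `j`, following the plan. -/
def SendsItem (j k : ℕ) (pl : Plan) : Prop :=
  pl.parent j = some vw.ident ∧
    ((∃ c b, vw.IsLatest k c ∧ vw.IsBase c b ∧ pl = vw.scheme.toPlan ∧
        vw.clock = b + pl.arrival j - vw.delay) ∨
      ∃ i c q, (i, c, q) ∈ vw.received ∧ q.item = some k ∧ pl = q.content.plan ∧
        vw.clock = c + (pl.arrival j - vw.delay - pl.arrival vw.ident))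

/-- Reports have to be sent now to node `j`. -/
def SendsReports (j : ℕ) : Prop :=
  vw.requests = ∅ ∧ 2 * vw.periodBound ≤ vw.clock ∧
    IsSlot vw.periodBound vw.delay vw.ownReport j (slot vw.periodBound vw.delay vw.ownReport j) ∧
    ∃ n : ℕ, vw.clock = (slot vw.periodBound vw.delay vw.ownReport j).1 +
      n * (slot vw.periodBound vw.delay vw.ownReport j).2

end View

open Classical in
/-- The nodes without requests flood their reports. A node with requests waits until its reports
are complete, and then broadcasts the items along a plan computed from these; the plan is sent
together with the items. -/
noncomputable def fastestBroadcast : Protocol where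
  Msg := Note
  send vw j :=
    if h : ∃ kp : ℕ × Plan, vw.SendsItem j kp.1 kp.2 then
      some ⟨⟨vw.clock, vw.know vw.clock, h.choose.2⟩, some h.choose.1⟩
    else if vw.SendsReports j then some ⟨⟨vw.clock, vw.know vw.clock, default⟩, none⟩
    else none
  terminal vw := ∃ k c b, vw.IsLatest k c ∧ vw.IsBase c b ∧ b + vw.scheme.duration ≤ vw.clock

/-! ### Correctness of the predictions -/

theorem shift_iff_of_periodic {f : ℝ → Prop} {q : ℝ} (hq : 0 < q)
    (h : ∀ t, 0 ≤ t → (f t ↔ f (t + q))) {t : ℝ} (m : ℤ) (ht : 0 ≤ t) (ht' : 0 ≤ t + m * q) :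
    f (t + m * q) ↔ f t := by
  have hnat : ∀ (n : ℕ) (t : ℝ), 0 ≤ t → (f (t + n * q) ↔ f t) := by
    intro n
    induction n with
    | zero => simp
    | succ n ih =>
      intro t ht
      rw [h t ht, ← ih (t + q) (by linarith)]
      push_cast
      rw [show t + ((n : ℝ) + 1) * q = t + q + n * q by ring]
  obtain ⟨n, rfl | rfl⟩ := m.eq_nat_or_neg
  · exact_mod_cast hnat n t ht
  · rw [← hnat n _ ht']
    push_cast
    rw [show t + -(n : ℝ) * q + n * q = t by ring]

namespace Setting

variable {V : Type} (S : Setting V)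

/-- The presence of the incident edges of `v`, until its clock shows twice the period bound. -/
def window (v : V) : Set (ℕ × ℝ) :=
  {jc | 0 ≤ jc.2 ∧ jc.2 ≤ 2 * S.periodBound ∧
    ∃ w, S.ident w = jc.1 ∧ (S.graph.snapshot (S.start v + jc.2)).Adj v w}

/-- The true report about `w`, with the clock of `v`. -/
def report (v w : V) : Report := (S.ident w, S.start w - S.start v, S.window w)

/-- All the reports, with the clock of the source. -/
def fullKnowledge : Set Report := Set.range (S.report S.source)

variable {S} {p q : ℝ}

theorem mem_window {v w : V} {c : ℝ} : (S.ident w, c) ∈ S.window v ↔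
    0 ≤ c ∧ c ≤ 2 * S.periodBound ∧ (S.graph.snapshot (S.start v + c)).Adj v w := by
  refine and_congr_right fun _ => and_congr_right fun _ => ?_
  constructor
  · rintro ⟨w', h1, h2⟩
    rwa [← S.ident_injective h1]
  · exact fun h => ⟨w, rfl, h⟩

/-- The true period is consistent with true records, so the choice in `windowPeriod` is not vacuous.
-/
theorem isWindowPeriod_report (hp : S.graph.IsPeriodic p) (hP : p ≤ S.periodBound) {K : Set Report}
    (hK : ∀ r ∈ K, ∃ v, r.2.2 = S.window v) : IsWindowPeriod S.periodBound K p := by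
  refine ⟨hp.1, hP, fun r hr j c h0 hc => ?_⟩
  obtain ⟨v, hv⟩ := hK r hr
  have := hp.1
  have h1 := hp.2 (S.start v + c) (add_nonneg (S.start_nonneg v) h0) 1 one_pos
  rw [Nat.cast_one, one_mul, add_assoc] at h1
  rw [hv]
  simp only [window, Set.mem_ofPred_eq, h1]
  constructor
  · rintro ⟨_, _, h⟩
    exact ⟨by linarith, by linarith, h⟩
  · rintro ⟨_, _, h⟩
    exact ⟨by linarith, by linarith, h⟩

/-- Shift `t` by a multiple of the true period `p` into `[start, start + p)`. As `p ≤ P` and `q ≤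
P`, both `t` and `t + q` then fall in the recorded window, where the consistency of `q` can be used.
Hence `q` is an actual period at `v`. -/
theorem adj_add_iff (hp : S.graph.IsPeriodic p) (hP : p ≤ S.periodBound) {K : Set Report} {v : V}
    (hq : IsWindowPeriod S.periodBound K q) {r : Report} (hr : r ∈ K) (hrv : r.2.2 = S.window v)
    (w : V) (t : ℝ) (ht : 0 ≤ t) :
    (S.graph.snapshot t).Adj v w ↔ (S.graph.snapshot (t + q)).Adj v w := by
  obtain ⟨m, hm1, hm2⟩ := TVG.exists_int_shift hp.1 t (S.start v)
  have h0 := S.start_nonneg v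
  have hq0 := hq.1
  have hqP := hq.2.1
  rw [← hp.snapshot_add m ht (by linarith),
    ← hp.snapshot_add (t := t + q) m (by linarith) (by linarith)]
  have h := hq.2.2 r hr (S.ident w) (t + m * p - S.start v) (by linarith) (by linarith)
  rw [hrv, mem_window, mem_window] at h
  constructor
  · intro h'
    have := (h.1 ⟨by linarith, by linarith, by rwa [add_sub_cancel]⟩).2.2
    rwa [show S.start v + (t + m * p - S.start v + q) = t + q + m * p by ring] at this
  · intro h'
    have := (h.2 ⟨by linarith, by linarith, by
      rwa [show S.start v + (t + m * p - S.start v + q) = t + q + m * p by ring]⟩).2.2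
    rwa [add_sub_cancel] at this

/-- Since `q` is an actual period at `v`, a representative of `c` in `[0, q)` decides presence. A
negative `c` is allowed as long as the date itself is nonnegative: the clock of the source may have
started earlier than that of `v`. -/
theorem predicted_iff (hp : S.graph.IsPeriodic p) (hP : p ≤ S.periodBound) {K : Set Report} {v : V}
    (hq : IsWindowPeriod S.periodBound K q) {r : Report} (hr : r ∈ K) (hrv : r.2.2 = S.window v)
    (w : V) {c : ℝ} (hc : 0 ≤ S.start v + c) :
    Predicted S.periodBound q (S.window v) (S.ident w) c ↔
      (S.graph.snapshot (S.start v + c)).Adj v w := by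
  have hper := adj_add_iff hp hP hq hr hrv w
  have h0 := S.start_nonneg v
  have hq0 := hq.1
  have hqP := hq.2.1
  constructor
  · rintro ⟨n, h1, h2, h3⟩
    have h4 := (mem_window.1 h3).2.2
    rw [← add_assoc] at h4
    exact (shift_iff_of_periodic (f := fun t => (S.graph.snapshot t).Adj v w) hq0 hper n hc
      (by linarith)).1 h4
  · intro h
    obtain ⟨n, hn1, hn2⟩ := TVG.exists_int_shift hq0 c 0
    refine ⟨n, hn1, by linarith, mem_window.2 ⟨hn1, by linarith, ?_⟩⟩
    rw [← add_assoc]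
    exact (shift_iff_of_periodic (f := fun t => (S.graph.snapshot t).Adj v w) hq0 hper n hc
      (by linarith)).2 h

theorem predictedCrossing_iff (hp : S.graph.IsPeriodic p) (hP : p ≤ S.periodBound)
    {K : Set Report} {v : V} (hq : IsWindowPeriod S.periodBound K q) {r : Report} (hr : r ∈ K)
    (hrv : r.2.2 = S.window v) (w : V) {c : ℝ} (hc : 0 ≤ S.start v + c) :
    PredictedCrossing S.periodBound S.graph.delay q (S.window v) (S.ident w) c ↔
      S.graph.Crossable v w (S.start v + c) := by
  constructor
  · intro h t ht
    have h1 := (predicted_iff hp hP hq hr hrv w (c := t - S.start v)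
      (by linarith [ht.1])).1 (h _ ⟨by linarith [ht.1], by linarith [ht.2]⟩)
    rwa [add_sub_cancel] at h1
  · intro h c' hc'
    exact (predicted_iff hp hP hq hr hrv w (by linarith [hc'.1])).2
      (h _ ⟨by linarith [hc'.1], by linarith [hc'.2]⟩)

variable (S) in
/-- The period used by the source. -/
noncomputable def cycle : ℝ := windowPeriod S.periodBound S.fullKnowledge

theorem isWindowPeriod_cycle (hp : S.graph.IsPeriodic p) (hP : p ≤ S.periodBound) :
    IsWindowPeriod S.periodBound S.fullKnowledge S.cycle := by
  refine Classical.epsilon_spec (p := IsWindowPeriod S.periodBound S.fullKnowledge)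
    ⟨p, isWindowPeriod_report hp hP ?_⟩
  rintro r ⟨v, rfl⟩
  exact ⟨v, rfl⟩

/-- With all reports at hand, consistency holds at every node at once, so the chosen value is a
period of the whole network, possibly other than `p`. -/
theorem isPeriodic_cycle (hp : S.graph.IsPeriodic p) (hP : p ≤ S.periodBound) :
    S.graph.IsPeriodic S.cycle := by
  have hq := isWindowPeriod_cycle hp hP
  refine TVG.isPeriodic_of_one hq.1 fun t ht => ?_
  ext v w
  exact adj_add_iff hp hP hq ⟨v, rfl⟩ rfl w t ht

theorem knownCrossing_iff (hp : S.graph.IsPeriodic p) (hP : p ≤ S.periodBound) {u v : V} {c : ℝ} :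
    KnownCrossing S.periodBound S.graph.delay (windowPeriod S.periodBound S.fullKnowledge)
      S.fullKnowledge (S.ident u) (S.ident v) c ↔
      0 ≤ c ∧ S.graph.Crossable u v (S.start S.source + c) := by
  refine and_congr_right fun hc => ?_
  have h0 := S.start_nonneg S.source
  have key := predictedCrossing_iff hp hP (isWindowPeriod_cycle hp hP) ⟨u, rfl⟩ (v := u) rfl v
    (c := c - (S.start u - S.start S.source)) (by linarith)
  rw [show S.start u + (c - (S.start u - S.start S.source)) = S.start S.source + c by ring] at key
  rw [← key]
  constructor
  · rintro ⟨o, W, ⟨u', h1⟩, h2⟩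
    simp only [report, Prod.mk.injEq] at h1
    obtain ⟨h3, rfl, rfl⟩ := h1
    obtain rfl := S.ident_injective h3
    exact h2
  · exact fun h => ⟨_, _, ⟨u, rfl⟩, h⟩

theorem reported_fullKnowledge : reported S.fullKnowledge = Set.range S.ident := by
  ext i
  simp [reported, fullKnowledge, report]

/-! ### Schemes -/

/-- The dates at which the nodes are reached when a scheme is executed in the `m`-th cycle. -/
noncomputable def reach (S : Setting V) (s : Scheme) (m : ℕ) (v : V) : ℝ :=
  S.start S.source + s.base + s.arrival (S.ident v) + m * S.cycle

/-- A good scheme in terms of the nodes and dates of the network. -/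
structure IsSound (S : Setting V) (s : Scheme) : Prop where
  base_nonneg : 0 ≤ s.base
  parent_source : s.parent (S.ident S.source) = none
  arrival_source : s.arrival (S.ident S.source) = 0
  exists_parent : ∀ v, v ≠ S.source → ∃ u, s.parent (S.ident v) = some (S.ident u) ∧
    s.arrival (S.ident u) + S.graph.delay ≤ s.arrival (S.ident v) ∧
    ∀ m, S.graph.Crossable u v (S.reach s m v - S.graph.delay)
  isArrival : ∀ m, S.graph.IsArrival S.source (S.reach s m)
  isForemost : ∀ m, S.graph.IsForemost (S.reach s m)
  optimal : ∀ β : V → ℝ, 0 ≤ β S.source → S.graph.IsArrival S.source β →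
    ∃ w, s.duration ≤ β w - β S.source
  arrival_le : ∀ v, s.arrival (S.ident v) ≤ s.duration
  exists_arrival_eq : ∃ v, s.arrival (S.ident v) = s.duration

theorem isSound_of_isGoodScheme [Finite V] (hp : S.graph.IsPeriodic p) (hP : p ≤ S.periodBound)
    {s : Scheme} (h : IsGoodScheme S.periodBound S.graph.delay (S.ident S.source)
      S.fullKnowledge s) : S.IsSound s := by
  have hq := isPeriodic_cycle hp hP
  have hd := S.graph.delay_pos
  have hs0 := S.start_nonneg S.source
  obtain ⟨h1, h2, h3, h4, h5, h6, h7, h8⟩ := h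
  simp only [reported_fullKnowledge, Set.forall_mem_range, Set.exists_range_iff,
    knownCrossing_iff hp hP, S.ident_injective.ne_iff] at h4 h5 h6 h7 h8
  have hreach : ∀ m, S.reach s m = fun v => S.reach s 0 v + (m : ℤ) * S.cycle := by
    intro m
    funext v
    simp [reach]
  have harr : S.graph.IsArrival S.source (S.reach s 0) := by
    intro v hv
    obtain ⟨u, -, hu2, -, hu4⟩ := h4 v hv
    refine ⟨u, by simp only [reach]; linarith, ?_⟩
    convert hu4 using 1
    simp only [reach]
    push_cast
    ring
  have hx0 : S.reach s 0 S.source = S.start S.source + s.base := by simp [reach, h3]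
  have hnn : ∀ v, S.start S.source + s.base ≤ S.reach s 0 v := fun v => hx0 ▸ harr.source_le v
  have hfor : S.graph.IsForemost (S.reach s 0) := by
    intro u v t hu hc
    have h9 : S.reach s 0 u = S.start S.source + s.base + s.arrival (S.ident u) := by simp [reach]
    have h10 : S.reach s 0 v = S.start S.source + s.base + s.arrival (S.ident v) := by simp [reach]
    have := h5 u v (t - S.start S.source) (by linarith)
      ⟨by linarith [hnn u], by rwa [add_sub_cancel]⟩
    linarith
  have hmq : ∀ m : ℕ, 0 ≤ (m : ℝ) * S.cycle := fun m => mul_nonneg m.cast_nonneg hq.1.le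
  refine ⟨h1, h2, h3, fun v hv => ?_, fun m => ?_, fun m => ?_, fun β hβ0 hβ => ?_, h7, h8⟩
  · obtain ⟨u, hu1, hu2, hu3, hu4⟩ := h4 v hv
    refine ⟨u, hu1, hu2, fun m => ?_⟩
    have := hq.crossable_add m hu4 (by push_cast; linarith [hmq m])
    convert this using 1
    simp only [reach]
    push_cast
    ring
  · rw [hreach]
    exact harr.shift hq m (by push_cast; linarith [hmq m])
  · rw [hreach]
    exact hfor.shift hq m fun v => by linarith [hnn v]
  -- The scheme is compared only with labellings nonnegative on the clock of the source; an earlier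
  -- broadcast `β` qualifies after a delay of whole cycles, which preserves its duration.
  · obtain ⟨m, hm⟩ := TVG.exists_nat_shift hq.1 (β S.source) (S.start S.source)
    have hβ' := hβ.shift hq (m : ℤ) (by push_cast; linarith)
    push_cast at hβ'
    obtain ⟨w, hw⟩ := h6 (Function.extend S.ident
      (fun v => β v + m * S.cycle - S.start S.source) 0)
      (by rw [S.ident_injective.extend_apply]; linarith) (by
        simp only [S.ident_injective.extend_apply]
        intro v hv
        obtain ⟨u, hu1, hu2⟩ := hβ' v hv
        refine ⟨u, by linarith, by linarith [hβ'.source_le u], ?_⟩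
        convert hu2 using 1
        ring)
    simp only [S.ident_injective.extend_apply] at hw
    exact ⟨w, by linarith⟩

theorem exists_isGoodScheme [Finite V] (hconn : S.graph.footprint.Connected)
    (hp : S.graph.IsPeriodic p) (hP : p ≤ S.periodBound) :
    ∃ s, IsGoodScheme S.periodBound S.graph.delay (S.ident S.source) S.fullKnowledge s := by
  classical
  have hd := S.graph.delay_pos
  -- The optimum is taken after the start of the source, so that the base is nonnegative on its
  -- clock.
  obtain ⟨α, hα1, hα0, hα2, hα3, hα4⟩ :=
    TVG.exists_optimal hp hconn S.source (S.start S.source)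
  have : Nonempty V := ⟨S.source⟩
  obtain ⟨w, hw⟩ := Finite.exists_max α
  have harr := hα2
  choose! par hpar1 hpar2 using hα2
  refine ⟨⟨⟨Function.extend S.ident (fun v => if v = S.source then none
    else some (S.ident (par v))) fun _ => none,
    Function.extend S.ident (fun v => α v - α S.source) 0⟩,
    α S.source - S.start S.source, α w - α S.source⟩, ?_⟩
  constructor <;>
    simp only [reported_fullKnowledge, Set.forall_mem_range, Set.exists_range_iff,
      knownCrossing_iff hp hP, S.ident_injective.ne_iff, S.ident_injective.extend_apply]
  · linarith
  · simp
  · ring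
  · intro v hv
    refine ⟨par v, by simp [hv], by linarith [hpar1 v hv], ?_, ?_⟩
    · linarith [hpar1 v hv, harr.source_le (par v)]
    · convert hpar2 v hv using 1
      ring
  · intro u v t hu ht
    linarith [hα3 u v _ (by linarith) ht.2]
  · intro β hβ0 hβ
    obtain ⟨w', hw'⟩ := hα4 (fun v => S.start S.source + β (S.ident v))
      (add_nonneg (S.start_nonneg _) hβ0) (by
        intro v hv
        obtain ⟨u, hu1, hu2, hu3⟩ := hβ v hv
        refine ⟨u, by linarith, ?_⟩
        convert hu3 using 1
        ring)
    exact ⟨w', by linarith [hw' w]⟩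
  · intro v
    linarith [hw v]
  · exact ⟨w, rfl⟩

variable (S) in
/-- The scheme used by the source. -/
noncomputable def scheme : Scheme :=
  goodScheme S.periodBound S.graph.delay (S.ident S.source) S.fullKnowledge

theorem isSound_scheme [Finite V] (hconn : S.graph.footprint.Connected)
    (hp : S.graph.IsPeriodic p) (hP : p ≤ S.periodBound) : S.IsSound S.scheme :=
  isSound_of_isGoodScheme hp hP (Classical.epsilon_spec (exists_isGoodScheme hconn hp hP))

end Setting

/-! ### The execution of the protocol -/

namespace Setting

variable {V : Type} (S : Setting V)

/-- The traffic of the execution. -/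
noncomputable def run : Traffic V Note := fastestBroadcast.traffic S

/-- The reports that `v` has at date `t`. -/
def knowledge (v : V) (t : ℝ) : Set Report := (S.view S.run v t).know (t - S.start v)

variable {S} {u v w : V} {t s p : ℝ} {k : ℕ} {pl : Plan} {q : Packet Note}

theorem run_eq (u v : V) (t : ℝ) : S.run u v t = fastestBroadcast.emission S S.run u v t :=
  (fastestBroadcast.existsUnique_isExecution S).choose_spec.1 u v t

theorem run_some (h : S.run u v t = some q) :
    S.start u ≤ t ∧ q.content.clock = t - S.start u ∧ q.content.know = S.knowledge u t ∧
      ((∃ k, (S.view S.run u t).SendsItem (S.ident v) k q.content.plan ∧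
          ∀ k', q.item = some k' → k' = k ∧ S.Holds S.run k u t) ∨
        (S.view S.run u t).SendsReports (S.ident v) ∧ q.item = none) := by
  classical
  rw [run_eq] at h
  unfold Protocol.emission at h
  split_ifs at h with h1
  obtain ⟨q', h2, rfl⟩ := Option.map_eq_some_iff.1 h
  refine ⟨h1, ?_⟩
  simp only [fastestBroadcast] at h2
  split_ifs at h2 with h3 h4
  · obtain rfl := Option.some.inj h2
    refine ⟨rfl, rfl, Or.inl ⟨h3.choose.1, h3.choose_spec, fun k' hk' => ?_⟩⟩
    obtain ⟨h5, h6⟩ := (Option.filter_eq_some_iff (o := some h3.choose.1)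
      (p := fun k => decide (S.Holds S.run k u t))).1 hk'
    obtain rfl := Option.some.inj h5
    exact ⟨rfl, of_decide_eq_true h6⟩
  · obtain rfl := Option.some.inj h2
    exact ⟨rfl, rfl, Or.inr ⟨h4, rfl⟩⟩

/-- The protocol picks one among the items due, so the item `k'` sent might a priori differ from
`k`; disjointness of the broadcasts later excludes this. -/
theorem exists_run_of_sendsItem (hs : S.start u ≤ t)
    (h : (S.view S.run u t).SendsItem (S.ident v) k pl) :
    ∃ k' pl' q, (S.view S.run u t).SendsItem (S.ident v) k' pl' ∧ S.run u v t = some q ∧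
      (S.Holds S.run k' u t → q.item = some k') := by
  classical
  have h' : ∃ kp : ℕ × Plan, (S.view S.run u t).SendsItem (S.ident v) kp.1 kp.2 := ⟨(k, pl), h⟩
  refine ⟨h'.choose.1, h'.choose.2, ⟨⟨t - S.start u, S.knowledge u t, h'.choose.2⟩,
    (some h'.choose.1).filter fun k => decide (S.Holds S.run k u t)⟩, h'.choose_spec, ?_, ?_⟩
  · rw [run_eq]
    unfold Protocol.emission
    rw [if_pos hs]
    simp only [fastestBroadcast]
    rw [dif_pos h']
    rfl
  · intro hH
    exact (Option.filter_eq_some_iff (o := some h'.choose.1)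
      (p := fun k => decide (S.Holds S.run k u t))).2 ⟨rfl, decide_eq_true hH⟩

/-- An item may take precedence over a mere report. This is harmless for flooding, as every packet
carries all the reports of its sender. -/
theorem exists_run_of_sendsReports (hs : S.start u ≤ t)
    (h : (S.view S.run u t).SendsReports (S.ident v)) : ∃ q, S.run u v t = some q := by
  classical
  rw [run_eq]
  unfold Protocol.emission
  rw [if_pos hs]
  simp only [fastestBroadcast]
  rw [if_pos h]
  split_ifs <;> exact ⟨_, rfl⟩

theorem run_nonneg (h : S.run u v t = some q) : 0 ≤ t :=
  (S.start_nonneg u).trans (run_some h).1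

/-- Induction along the dates at which packets are sent. -/
theorem date_induction {P : ℝ → Prop} {z : ℝ} (hz : 0 < z)
    (h : ∀ t, (∀ s, 0 ≤ s → s + z ≤ t → P s) → P t) (t : ℝ) : P t := by
  have key : ∀ (n : ℕ) (t : ℝ), t < n * z → P t := by
    intro n
    induction n with
    | zero =>
      intro t ht
      exact h t fun s hs hst => by
        simp only [CharP.cast_eq_zero, zero_mul] at ht
        linarith
    | succ n ih =>
      intro t ht
      refine h t fun s hs hst => ih s ?_
      push_cast at ht
      linarith
  obtain ⟨n, hn⟩ := exists_nat_gt (t / z)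
  exact key n t ((div_lt_iff₀ hz).1 hn)

theorem mem_received {j : ℕ} {c : ℝ} : (j, c, q) ∈ (S.view S.run v t).received ↔
    0 ≤ c ∧ S.start v + c ≤ t ∧
      ∃ u, S.ident u = j ∧ S.Delivered S.run u v (S.start v + c - S.graph.delay) q :=
  Iff.rfl

/-! ### The reports -/

theorem ownReport_view (h : 2 * S.periodBound ≤ t - S.start v) :
    (S.view S.run v t).ownReport = S.report v v := by
  simp only [View.ownReport, report, sub_self, Prod.mk.injEq]
  refine ⟨rfl, trivial, ?_⟩
  ext ⟨j, c⟩
  constructor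
  · rintro ⟨⟨h1, h2, h3⟩, h4⟩
    exact ⟨h1, h4, h3⟩
  · rintro ⟨h1, h2, h3⟩
    have h2' : c ≤ 2 * S.periodBound := h2
    exact ⟨⟨h1, by change S.start v + c ≤ t; linarith, h3⟩, h2⟩

/-- On the clock of the receiver, the arrival time minus the delay is the sending time; subtracting
the sender's time stamp leaves the difference of the two starts, which is exactly the correction of
the offset. -/
theorem mem_know_view (hst : s ≤ t) {r : Report} :
    r ∈ (S.view S.run v t).know (s - S.start v) ↔
      (2 * S.periodBound ≤ s - S.start v ∧ r = S.report v v) ∨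
      ∃ u d q, ∃ r' ∈ S.knowledge u d, S.Delivered S.run u v d q ∧
        S.start v ≤ d + S.graph.delay ∧ d + S.graph.delay ≤ s ∧
        r = (r'.1, r'.2.1 + (S.start u - S.start v), r'.2.2) := by
  refine or_congr (and_congr_right fun h => ?_) ⟨?_, ?_⟩
  · rw [ownReport_view (h.trans (by linarith))]
  · rintro ⟨j, c, q, r', h1, h2, h3, rfl⟩
    obtain ⟨h4, h5, u, rfl, h6⟩ := mem_received.1 h1
    obtain ⟨h7, h8, h9, -⟩ := run_some h6.1
    refine ⟨u, _, q, r', h9 ▸ h3, h6, by linarith, by linarith, ?_⟩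
    have : (S.view S.run v t).delay = S.graph.delay := rfl
    rw [h8, this]
    congr 2
    ring
  · rintro ⟨u, d, q, r', h1, h2, h3, h4, rfl⟩
    obtain ⟨h7, h8, h9, -⟩ := run_some h2.1
    refine ⟨S.ident u, d + S.graph.delay - S.start v, q, r', mem_received.2
      ⟨by linarith, by linarith, u, rfl, ?_⟩, by linarith, h9 ▸ h1, ?_⟩
    · rwa [show S.start v + (d + S.graph.delay - S.start v) - S.graph.delay = d by ring]
    · have : (S.view S.run v t).delay = S.graph.delay := rfl
      rw [h8, this]
      congr 2
      ring

/-- Past knowledge can be recomputed from a later view. This lets the source decide now whether an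
earlier cycle was ready, with an answer that does not change over time. -/
theorem know_view (hst : s ≤ t) :
    (S.view S.run v t).know (s - S.start v) = S.knowledge v s := by
  ext r
  rw [mem_know_view hst, knowledge, mem_know_view le_rfl]

theorem mem_knowledge {r : Report} : r ∈ S.knowledge v t ↔
      (2 * S.periodBound ≤ t - S.start v ∧ r = S.report v v) ∨
      ∃ u d q, ∃ r' ∈ S.knowledge u d, S.Delivered S.run u v d q ∧
        S.start v ≤ d + S.graph.delay ∧ d + S.graph.delay ≤ t ∧
        r = (r'.1, r'.2.1 + (S.start u - S.start v), r'.2.2) :=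
  mem_know_view le_rfl

theorem knowledge_mono (hst : s ≤ t) : S.knowledge v s ⊆ S.knowledge v t := by
  intro r hr
  rw [mem_knowledge] at hr ⊢
  refine hr.imp (fun h => ⟨by linarith, h.2⟩) ?_
  rintro ⟨u, d, q, r', h1, h2, h3, h4, h5⟩
  exact ⟨u, d, q, r', h1, h2, h3, h4.trans hst, h5⟩

theorem report_trans (u v w : V) :
    ((S.report u w).1, (S.report u w).2.1 + (S.start u - S.start v), (S.report u w).2.2) =
      S.report v w := by
  simp only [report]
  congr 2
  ring

theorem exists_report_of_mem_knowledge {r : Report} (hr : r ∈ S.knowledge v t) :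
    ∃ w, r = S.report v w := by
  revert v r
  refine date_induction (P := fun t => ∀ {v : V} {r : Report}, r ∈ S.knowledge v t →
    ∃ w, r = S.report v w) S.graph.delay_pos (fun t ih v r hr => ?_) t
  rcases mem_knowledge.1 hr with ⟨-, rfl⟩ | ⟨u, d, q, r', h1, h2, h3, h4, rfl⟩
  · exact ⟨v, rfl⟩
  · obtain ⟨w, rfl⟩ := ih d (run_nonneg h2.1) h4 h1
    exact ⟨w, report_trans u v w⟩

/-- Walk from the source through the footprint. Each edge is present at some time in `[0, P]` on the
clock of its endpoint, so it shows in the record of that node, and completeness passes on to the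
neighbour. -/
theorem knowledge_eq_full (hconn : S.graph.footprint.Connected) (hp : S.graph.IsPeriodic p)
    (hP : p ≤ S.periodBound)
    (h : ReportsComplete (S.ident S.source) (S.knowledge S.source t)) :
    S.knowledge S.source t = S.fullKnowledge := by
  have hmem : ∀ w, S.ident w ∈ reported (S.knowledge S.source t) →
      S.report S.source w ∈ S.knowledge S.source t := by
    rintro w ⟨r, hr, hrw⟩
    obtain ⟨w', rfl⟩ := exists_report_of_mem_knowledge hr
    rwa [← S.ident_injective hrw]
  refine Set.Subset.antisymm (fun r hr => ?_) ?_
  · obtain ⟨w, rfl⟩ := exists_report_of_mem_knowledge hr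
    exact ⟨w, rfl⟩
  · have key : ∀ (a b : V) (_ : S.graph.footprint.Walk a b), b = S.source →
        S.ident a ∈ reported (S.knowledge S.source t) := by
      intro a b wk
      induction wk with
      | nil =>
        rintro rfl
        exact h.1
      | @cons a c b hadj _ ih =>
        intro hb
        obtain ⟨d, hd, h1, h2⟩ := hp.exists_crossable_mem hadj.symm (S.start_nonneg c)
        have hpp := hp.1
        refine h.2 _ (hmem c (ih hb)) (S.ident a, d - S.start c)
          (mem_window.2 ⟨by linarith, by linarith, ?_⟩)
        rw [add_sub_cancel]
        exact hd.adj
    rintro r ⟨w, rfl⟩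
    obtain ⟨wk⟩ := hconn.preconnected w S.source
    exact hmem w (key _ _ wk rfl)

theorem reportsComplete_full (x : V) : ReportsComplete (S.ident x) S.fullKnowledge := by
  rw [ReportsComplete, reported_fullKnowledge]
  refine ⟨⟨x, rfl⟩, ?_⟩
  rintro r ⟨w, rfl⟩ jc ⟨-, -, w', h, -⟩
  exact ⟨w', h⟩

/-! ### Flooding of the reports to the source -/

theorem slot_spec (hp : S.graph.IsPeriodic p) (hP : p ≤ S.periodBound)
    (h : S.graph.footprint.Adj u v) :
    IsSlot S.periodBound S.graph.delay (S.report u u) (S.ident v)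
      (slot S.periodBound S.graph.delay (S.report u u) (S.ident v)) := by
  obtain ⟨c, hc, h1, -⟩ := hp.exists_crossable_mem h (S.start_nonneg u)
  have hw : IsWindowPeriod S.periodBound {S.report u u} p :=
    isWindowPeriod_report hp hP fun r hr => ⟨u, by rw [Set.mem_singleton_iff.1 hr]; rfl⟩
  refine Classical.epsilon_spec (p := IsSlot S.periodBound S.graph.delay (S.report u u)
    (S.ident v)) ⟨(c - S.start u, p), by linarith, hw, ?_⟩
  refine (predictedCrossing_iff hp hP hw rfl rfl v (c := c - S.start u)
    (by linarith [hc.nonneg])).2 ?_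
  rwa [add_sub_cancel]

theorem requests_eq_empty (hu : u ≠ S.source) : (S.view S.run u t).requests = ∅ := by
  ext kc
  simp [view, hu]

theorem report_spreads (hp : S.graph.IsPeriodic p) (hP : p ≤ S.periodBound)
    (hu : u ≠ S.source) (hadj : S.graph.footprint.Adj u v)
    (h : ∃ T, ∀ t, T ≤ t → S.report u w ∈ S.knowledge u t) :
    ∃ T, ∀ t, T ≤ t → S.report v w ∈ S.knowledge v t := by
  obtain ⟨T, hT⟩ := h
  have hs := slot_spec hp hP hadj
  obtain ⟨h1, h2, h3⟩ := hs
  set c := slot S.periodBound S.graph.delay (S.report u u) (S.ident v) with hc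
  have h3' := (predictedCrossing_iff hp hP h2 rfl rfl v
    (by linarith [S.start_nonneg u])).1 h3
  -- A slot late enough that `u` has the report and a full record of its own, and that `v` has
  -- started.
  obtain ⟨n, hn⟩ := TVG.exists_nat_shift h2.1 (S.start u + c.1)
    (max T (max (S.start v) (S.start u + 2 * S.periodBound)))
  obtain ⟨hn1, hn2⟩ := max_le_iff.1 hn
  obtain ⟨hn3, hn4⟩ := max_le_iff.1 hn2
  have hpp := hp.1
  have hd := S.graph.delay_pos
  set d := S.start u + c.1 + n * c.2 with hdd
  have hcross : S.graph.Crossable u v d := by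
    intro t' ht'
    have h0 := S.start_nonneg u
    have h5 := h3' (t' - n * c.2) ⟨by linarith [ht'.1], by linarith [ht'.2]⟩
    have h6 := (shift_iff_of_periodic (f := fun t => (S.graph.snapshot t).Adj u v) h2.1
      (adj_add_iff hp hP h2 rfl rfl v) (t := t' - n * c.2) n (by linarith [ht'.1])
      (by push_cast; linarith [ht'.1])).2 h5
    push_cast at h6
    rwa [sub_add_cancel] at h6
  obtain ⟨q, hq⟩ : ∃ q, S.run u v d = some q := by
    refine exists_run_of_sendsReports (by linarith) ⟨requests_eq_empty hu, ?_, ?_⟩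
    · change 2 * S.periodBound ≤ d - S.start u
      linarith
    · rw [ownReport_view (by linarith)]
      refine ⟨⟨h1, h2, h3⟩, n, ?_⟩
      change d - S.start u = c.1 + n * c.2
      rw [hdd]
      ring
  exact ⟨d + S.graph.delay, fun t ht => mem_knowledge.2 (Or.inr
    ⟨u, d, q, _, hT d hn1, ⟨hq, hcross⟩, by linarith, ht, (report_trans u v w).symm⟩)⟩

/-- Each report spreads along a walk to the source. The walk is cut at its first visit to the
source, which need not forward reports. -/
theorem eventually_full [Finite V] (hconn : S.graph.footprint.Connected)
    (hp : S.graph.IsPeriodic p) (hP : p ≤ S.periodBound) :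
    ∃ T, ∀ t, T ≤ t → ReportsComplete (S.ident S.source) (S.knowledge S.source t) := by
  have hw : ∀ w, ∃ T, ∀ t, T ≤ t → S.report S.source w ∈ S.knowledge S.source t := by
    intro w
    have key : ∀ (u v : V) (_ : S.graph.footprint.Walk u v), v = S.source →
        (∃ T, ∀ t, T ≤ t → S.report u w ∈ S.knowledge u t) →
        ∃ T, ∀ t, T ≤ t → S.report S.source w ∈ S.knowledge S.source t := by
      intro u v wk
      induction wk with
      | nil =>
        rintro rfl h
        exact h
      | @cons a b c hadj _ ih =>
        intro hc h
        by_cases ha : a = S.source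
        · exact ha ▸ h
        · exact ih hc (report_spreads hp hP ha hadj h)
    obtain ⟨wk⟩ := hconn.preconnected w S.source
    exact key _ _ wk rfl ⟨S.start w + 2 * S.periodBound, fun t ht =>
      mem_knowledge.2 (Or.inl ⟨by linarith, rfl⟩)⟩
  choose T hT using hw
  obtain ⟨M, hM⟩ := (Set.finite_range T).bddAbove
  refine ⟨M, fun t ht => ?_⟩
  have : S.knowledge S.source t = S.fullKnowledge := by
    refine Set.Subset.antisymm (fun r hr => ?_) ?_
    · obtain ⟨w, rfl⟩ := exists_report_of_mem_knowledge hr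
      exact ⟨w, rfl⟩
    · rintro r ⟨w, rfl⟩
      exact hT w t ((hM ⟨w, rfl⟩).trans ht)
  rw [this]
  exact reportsComplete_full _

end Setting

/-! ### Admissible settings and the planned dates -/

namespace Setting

variable {V : Type}

/-- The network is connected and periodic, with a period below the known bound. -/
structure IsAdmissible (S : Setting V) : Prop where
  connected : S.graph.footprint.Connected
  periodic : ∃ p, S.graph.IsPeriodic p ∧ p ≤ S.periodBound

/-- The date at which the `m`-th cycle of the scheme begins. -/
noncomputable def cycleDate (S : Setting V) (m : ℕ) : ℝ :=
  S.start S.source + S.scheme.base + m * S.cycle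

def ReadyAt (S : Setting V) (k m : ℕ) : Prop :=
  S.request k ≤ S.cycleDate m ∧
    ReportsComplete (S.ident S.source) (S.knowledge S.source (S.cycleDate m))

/-- The cycle in which item `k` is broadcast. -/
noncomputable def firstCycle (S : Setting V) (k : ℕ) : ℕ := sInf {m | S.ReadyAt k m}

/-- The date at which the broadcast of item `k` begins. -/
noncomputable def broadcastDate (S : Setting V) (k : ℕ) : ℝ := S.cycleDate (S.firstCycle k)

/-- The date at which node `v` gets item `k`. -/
noncomputable def arrivalDate (S : Setting V) (k : ℕ) (v : V) : ℝ :=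
  S.broadcastDate k + S.scheme.arrival (S.ident v)

variable {S : Setting V} {u v w : V} {t s : ℝ} {k k' : ℕ} {pl : Plan} {q : Packet Note}

theorem arrivalDate_eq_reach : S.arrivalDate k = S.reach S.scheme (S.firstCycle k) := by
  funext v
  simp only [arrivalDate, broadcastDate, cycleDate, reach]
  ring

theorem IsAdmissible.isPeriodic_cycle (hS : S.IsAdmissible) : S.graph.IsPeriodic S.cycle := by
  obtain ⟨p, hp, hP⟩ := hS.periodic
  exact Setting.isPeriodic_cycle hp hP

theorem IsAdmissible.knowledge_eq_full (hS : S.IsAdmissible)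
    (h : ReportsComplete (S.ident S.source) (S.knowledge S.source t)) :
    S.knowledge S.source t = S.fullKnowledge := by
  obtain ⟨p, hp, hP⟩ := hS.periodic
  exact Setting.knowledge_eq_full hS.connected hp hP h

theorem IsAdmissible.isSound [Finite V] (hS : S.IsAdmissible) : S.IsSound S.scheme := by
  obtain ⟨p, hp, hP⟩ := hS.periodic
  exact isSound_scheme hS.connected hp hP

/-- A new report could name an unreported neighbour, so completeness is not monotone by itself. It
persists because complete reports are already all the reports. -/
theorem IsAdmissible.complete_mono (hS : S.IsAdmissible) (hst : s ≤ t)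
    (h : ReportsComplete (S.ident S.source) (S.knowledge S.source s)) :
    ReportsComplete (S.ident S.source) (S.knowledge S.source t) := by
  have : S.knowledge S.source t = S.fullKnowledge := by
    refine Set.Subset.antisymm (fun r hr => ?_) (hS.knowledge_eq_full h ▸ knowledge_mono hst)
    obtain ⟨w, rfl⟩ := exists_report_of_mem_knowledge hr
    exact ⟨w, rfl⟩
  rw [this]
  exact reportsComplete_full _

/-! ### The start of a broadcast -/

theorem IsAdmissible.readyAt_firstCycle [Finite V] (hS : S.IsAdmissible) (k : ℕ) :
    S.ReadyAt k (S.firstCycle k) := by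
  obtain ⟨p, hp, hP⟩ := hS.periodic
  obtain ⟨T, hT⟩ := eventually_full hS.connected hp hP
  obtain ⟨m, hm⟩ := TVG.exists_nat_shift hS.isPeriodic_cycle.1
    (S.start S.source + S.scheme.base) (max T (S.request k))
  exact Nat.sInf_mem (s := {m | S.ReadyAt k m})
    ⟨m, (le_max_right _ _).trans hm, hT _ ((le_max_left _ _).trans hm)⟩

theorem IsAdmissible.request_le [Finite V] (hS : S.IsAdmissible) (k : ℕ) :
    S.request k ≤ S.broadcastDate k :=
  (hS.readyAt_firstCycle k).1

theorem IsAdmissible.view_cycle (hS : S.IsAdmissible)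
    (h : ReportsComplete (S.ident S.source) (S.knowledge S.source t)) :
    (S.view S.run S.source t).cycle = S.cycle := by
  have := hS.knowledge_eq_full h
  rw [cycle, ← this]
  rfl

theorem IsAdmissible.view_scheme (hS : S.IsAdmissible)
    (h : ReportsComplete (S.ident S.source) (S.knowledge S.source t)) :
    (S.view S.run S.source t).scheme = S.scheme := by
  have := hS.knowledge_eq_full h
  rw [scheme, ← this]
  rfl

theorem IsAdmissible.ready_iff (hS : S.IsAdmissible)
    (h : ReportsComplete (S.ident S.source) (S.knowledge S.source t)) {m : ℕ}
    (hm : S.cycleDate m ≤ t) :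
    (S.view S.run S.source t).Ready (S.request k - S.start S.source) m ↔ S.ReadyAt k m := by
  have h1 : S.scheme.base + m * S.cycle = S.cycleDate m - S.start S.source := by
    simp only [cycleDate]
    ring
  rw [View.Ready, hS.view_cycle h, hS.view_scheme h, h1, know_view hm]
  exact and_congr_left fun _ => sub_le_sub_iff_right _

/-- Before completeness the scheme in the view may be arbitrary. But readiness demands complete
reports at a date already past, so a recognised base is always computed from the final scheme and
cycle. -/
theorem IsAdmissible.isBase_iff [Finite V] (hS : S.IsAdmissible) {b : ℝ} :
    (S.view S.run S.source t).IsBase (S.request k - S.start S.source) b ↔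
      S.broadcastDate k ≤ t ∧ b = S.broadcastDate k - S.start S.source := by
  have hbase : ∀ m : ℕ, S.scheme.base + m * S.cycle = S.cycleDate m - S.start S.source := by
    intro m
    simp only [cycleDate]
    ring
  have hmono : Monotone S.cycleDate := by
    intro m m' hmm
    have := hS.isPeriodic_cycle.1
    simp only [cycleDate]
    gcongr
  constructor
  · rintro ⟨m, hb, hr, hmin, hle⟩
    have hle' : S.start S.source + b ≤ t := by
      have : b ≤ t - S.start S.source := hle
      linarith
    have hc : ReportsComplete (S.ident S.source) (S.knowledge S.source t) := by
      have h2 := hr.2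
      rw [← hb, show b = S.start S.source + b - S.start S.source by ring, know_view hle'] at h2
      exact hS.complete_mono hle' h2
    rw [hS.view_cycle hc, hS.view_scheme hc, hbase] at hb
    have hmt : S.cycleDate m ≤ t := by linarith
    rw [hS.ready_iff hc hmt] at hr
    have hfirst : S.firstCycle k = m := by
      refine le_antisymm (Nat.sInf_le hr) (not_lt.1 fun hlt => ?_)
      exact hmin _ hlt ((hS.ready_iff hc ((hmono hlt.le).trans hmt)).2 (hS.readyAt_firstCycle k))
    rw [broadcastDate, hfirst]
    exact ⟨hmt, hb⟩
  · rintro ⟨hle, rfl⟩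
    have hr := hS.readyAt_firstCycle k
    have hc := hS.complete_mono hle hr.2
    refine ⟨S.firstCycle k, ?_, (hS.ready_iff hc hle).2 hr, fun m' hm' h => ?_,
      sub_le_sub_right hle _⟩
    · rw [hS.view_cycle hc, hS.view_scheme hc, hbase]
      rfl
    · rw [hS.ready_iff hc ((hmono hm'.le).trans hle)] at h
      exact Nat.notMem_of_lt_sInf hm' h

theorem IsAdmissible.view_scheme_of_le [Finite V] (hS : S.IsAdmissible)
    (h : S.broadcastDate k ≤ t) : (S.view S.run S.source t).scheme = S.scheme :=
  hS.view_scheme (hS.complete_mono h (hS.readyAt_firstCycle k).2)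

/-! ### The emissions of an item -/

theorem mem_requests {c : ℝ} : (k, c) ∈ (S.view S.run u t).requests ↔
    u = S.source ∧ k < S.numRequests ∧ c = S.request k - S.start u ∧ S.request k ≤ t := by
  constructor
  · rintro ⟨h1, h2, h3, h4⟩
    have h3' : S.request k = S.start u + c := h3
    have h4' : S.start u + c ≤ t := h4
    exact ⟨h1, h2, by linarith, by linarith⟩
  · rintro ⟨h1, h2, h3, h4⟩
    refine ⟨h1, h2, ?_, ?_⟩
    · change S.request k = S.start u + c
      linarith
    · change S.start u + c ≤ t
      linarith

/-- Item `k` is sent along the plan only. -/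
theorem IsAdmissible.sendsItem [Finite V] (hS : S.IsAdmissible)
    (h : (S.view S.run u t).SendsItem (S.ident v) k pl) :
    k < S.numRequests ∧ pl = S.scheme.toPlan ∧ t = S.arrivalDate k v - S.graph.delay ∧
      S.scheme.parent (S.ident v) = some (S.ident u) := by
  revert u v k pl
  refine date_induction (P := fun t => ∀ {u v : V} {k : ℕ} {pl : Plan},
    (S.view S.run u t).SendsItem (S.ident v) k pl →
    k < S.numRequests ∧ pl = S.scheme.toPlan ∧ t = S.arrivalDate k v - S.graph.delay ∧
      S.scheme.parent (S.ident v) = some (S.ident u))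
    S.graph.delay_pos (fun t ih u v k pl h => ?_) t
  obtain ⟨hpar, ⟨c, b, h1, h2, h3, h4⟩ | ⟨i, c, q, h1, h2, h3, h4⟩⟩ := h
  · obtain ⟨rfl, h5, rfl, h6⟩ := mem_requests.1 h1.1
    obtain ⟨h7, rfl⟩ := hS.isBase_iff.1 h2
    rw [hS.view_scheme_of_le h7] at h3
    subst h3
    have h4' : t - S.start S.source = S.broadcastDate k - S.start S.source +
      S.scheme.arrival (S.ident v) - S.graph.delay := h4
    exact ⟨h5, rfl, by rw [arrivalDate]; linarith, hpar⟩
  -- The relayed packet was sent at least one delay earlier. By induction it carries the source's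
  -- plan and came in on schedule, so the waiting time of the relay leads to the planned date.
  · obtain ⟨h5, h6, w, rfl, h7⟩ := mem_received.1 h1
    obtain ⟨h8, -, -, ⟨k', h9, h10⟩ | ⟨-, h9⟩⟩ := run_some h7.1
    · obtain ⟨rfl, -⟩ := h10 k h2
      obtain ⟨h11, h12, h13, h14⟩ := ih _ (run_nonneg h7.1) (by linarith) h9
      rw [← h3] at h12
      subst h12
      have h4' : t - S.start u = c + (S.scheme.arrival (S.ident v) - S.graph.delay -
        S.scheme.arrival (S.ident u)) := h4
      refine ⟨h11, rfl, ?_, hpar⟩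
      rw [arrivalDate] at h13 ⊢
      linarith
    · rw [h2] at h9
      cases h9

theorem IsAdmissible.run_item [Finite V] (hS : S.IsAdmissible)
    (h : S.run u v t = some q) (hk : q.item = some k) :
    k < S.numRequests ∧ q.content.plan = S.scheme.toPlan ∧
      t = S.arrivalDate k v - S.graph.delay ∧
      S.scheme.parent (S.ident v) = some (S.ident u) := by
  obtain ⟨-, -, -, ⟨k', h1, h2⟩ | ⟨-, h1⟩⟩ := run_some h
  · obtain ⟨rfl, -⟩ := h2 k hk
    exact hS.sendsItem h1
  · rw [hk] at h1
    cases h1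

theorem IsAdmissible.delay_le_arrival [Finite V] (hS : S.IsAdmissible) (hv : v ≠ S.source) :
    S.graph.delay ≤ S.scheme.arrival (S.ident v) := by
  have h := (hS.isSound.isArrival 0).source_add_delay_le hv
  simp only [reach, hS.isSound.arrival_source] at h
  linarith

theorem IsAdmissible.arrival_nonneg [Finite V] (hS : S.IsAdmissible) (v : V) :
    0 ≤ S.scheme.arrival (S.ident v) := by
  by_cases hv : v = S.source
  · rw [hv, hS.isSound.arrival_source]
  · exact S.graph.delay_pos.le.trans (hS.delay_le_arrival hv)

/-- The right end is excluded because the last crossing still takes one positive delay; this keeps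
the source silent at the very date of termination. -/
theorem IsAdmissible.emission_mem [Finite V] (hS : S.IsAdmissible)
    (ht : t = S.arrivalDate k v - S.graph.delay)
    (hpar : S.scheme.parent (S.ident v) = some (S.ident u)) :
    S.broadcastDate k ≤ t ∧ t < S.broadcastDate k + S.scheme.duration := by
  have hv : v ≠ S.source := by
    rintro rfl
    rw [hS.isSound.parent_source] at hpar
    cases hpar
  have h1 := hS.delay_le_arrival hv
  have h2 := hS.isSound.arrival_le v
  have h3 := S.graph.delay_pos
  rw [ht, arrivalDate]
  constructor <;> linarith

end Setting

namespace Setting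

variable {V : Type} {S : Setting V} {u v w : V} {t s : ℝ} {k k' : ℕ} {pl : Plan} {q : Packet Note}

/-! ### The sequence of broadcasts -/

theorem request_lt (hO : fastestBroadcast.RequestsInOrder S) (h : k < k')
    (hk' : k' < S.numRequests) : S.request k < S.request k' := by
  induction k', h using Nat.le_induction with
  | base =>
    obtain ⟨t, ht, -⟩ := hO k hk'
    exact ht.1.trans_lt (ht.2 hk')
  | succ n _ ih =>
    obtain ⟨t, ht, -⟩ := hO n hk'
    exact (ih (by omega)).trans (ht.1.trans_lt (ht.2 hk'))

theorem request_mono (hO : fastestBroadcast.RequestsInOrder S) (h : k ≤ k')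
    (hk' : k' < S.numRequests) : S.request k ≤ S.request k' := by
  rcases h.eq_or_lt with rfl | h
  · exact le_rfl
  · exact (request_lt hO h hk').le

theorem IsAdmissible.start_le_broadcastDate [Finite V] (hS : S.IsAdmissible)
    (hO : fastestBroadcast.RequestsInOrder S) (hk : k < S.numRequests) (v : V) :
    S.start v ≤ S.broadcastDate k :=
  (S.start_le v).trans ((request_mono hO (Nat.zero_le k) hk).trans (hS.request_le k))

theorem isLatest_iff (hO : fastestBroadcast.RequestsInOrder S) (hk : k < S.numRequests)
    (hc : S.Current k t) {c : ℝ} : (S.view S.run S.source t).IsLatest k' c ↔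
      k' = k ∧ c = S.request k - S.start S.source := by
  constructor
  · rintro ⟨h1, h2⟩
    obtain ⟨-, h3, rfl, h4⟩ := mem_requests.1 h1
    have h5 := h2 k _ (mem_requests.2 ⟨rfl, hk, rfl, hc.1⟩)
    obtain rfl | h6 := h5.eq_or_lt
    · exact ⟨rfl, rfl⟩
    · exact absurd (hc.2 (by omega)) (not_lt.2 ((request_mono hO h6 h3).trans h4))
  · rintro ⟨rfl, rfl⟩
    refine ⟨mem_requests.2 ⟨rfl, hk, rfl, hc.1⟩, fun k'' c' h => ?_⟩
    obtain ⟨-, h3, -, h4⟩ := mem_requests.1 h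
    by_contra hlt
    push Not at hlt
    exact absurd (hc.2 (by omega)) (not_lt.2 ((request_mono hO hlt h3).trans h4))

theorem IsAdmissible.terminal_iff [Finite V] (hS : S.IsAdmissible)
    (hO : fastestBroadcast.RequestsInOrder S) (hk : k < S.numRequests) (hc : S.Current k t) :
    fastestBroadcast.Terminal S t ↔ S.broadcastDate k + S.scheme.duration ≤ t := by
  have hd : 0 ≤ S.scheme.duration := (hS.arrival_nonneg S.source).trans (hS.isSound.arrival_le _)
  change (∃ k' c b, (S.view S.run S.source t).IsLatest k' c ∧
    (S.view S.run S.source t).IsBase c b ∧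
    b + (S.view S.run S.source t).scheme.duration ≤ t - S.start S.source) ↔ _
  constructor
  · rintro ⟨k', c, b, h1, h2, h3⟩
    obtain ⟨rfl, rfl⟩ := (isLatest_iff hO hk hc).1 h1
    obtain ⟨h4, rfl⟩ := hS.isBase_iff.1 h2
    rw [hS.view_scheme_of_le h4] at h3
    linarith
  · intro h
    have h4 : S.broadcastDate k ≤ t := by linarith
    refine ⟨k, _, _, (isLatest_iff hO hk hc).2 ⟨rfl, rfl⟩, hS.isBase_iff.2 ⟨h4, rfl⟩, ?_⟩
    rw [hS.view_scheme_of_le h4]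
    linarith

/-- The only use of the assumption that the source sees termination before the next request is to
separate consecutive broadcasts in time; here the terminal state is translated into that separation.
-/
theorem IsAdmissible.finish_lt_request [Finite V] (hS : S.IsAdmissible)
    (hO : fastestBroadcast.RequestsInOrder S) (h : k < k') (hk' : k' < S.numRequests) :
    S.broadcastDate k + S.scheme.duration < S.request k' := by
  obtain ⟨t, hc, ht⟩ := hO k (by omega)
  have h1 := (hS.terminal_iff hO (by omega) hc).1 ht
  exact (h1.trans_lt (hc.2 (by omega))).trans_le (request_mono hO h hk')

theorem IsAdmissible.current [Finite V] (hS : S.IsAdmissible)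
    (hO : fastestBroadcast.RequestsInOrder S) (h1 : S.broadcastDate k ≤ t)
    (h2 : t ≤ S.broadcastDate k + S.scheme.duration) : S.Current k t :=
  ⟨(hS.request_le k).trans h1, fun h =>
    h2.trans_lt (hS.finish_lt_request hO (Nat.lt_succ_self k) h)⟩

theorem IsAdmissible.item_unique [Finite V] (hS : S.IsAdmissible)
    (hO : fastestBroadcast.RequestsInOrder S) (hk : k < S.numRequests) (hk' : k' < S.numRequests)
    (h : S.broadcastDate k ≤ t ∧ t < S.broadcastDate k + S.scheme.duration)
    (h' : S.broadcastDate k' ≤ t ∧ t < S.broadcastDate k' + S.scheme.duration) : k = k' := by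
  rcases lt_trichotomy k k' with hlt | heq | hlt
  · have := hS.finish_lt_request hO hlt hk'
    linarith [hS.request_le k']
  · exact heq
  · have := hS.finish_lt_request hO hlt hk
    linarith [hS.request_le k]

theorem IsAdmissible.exists_run_item [Finite V] (hS : S.IsAdmissible)
    (hO : fastestBroadcast.RequestsInOrder S) (hs : S.start u ≤ t)
    (h : (S.view S.run u t).SendsItem (S.ident v) k pl) (hH : S.Holds S.run k u t) :
    ∃ q, S.run u v t = some q ∧ q.item = some k := by
  obtain ⟨k', pl', q, h1, h2, h3⟩ := exists_run_of_sendsItem hs h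
  obtain ⟨h4, -, h5, h6⟩ := hS.sendsItem h
  obtain ⟨h4', -, h5', h6'⟩ := hS.sendsItem h1
  obtain rfl := hS.item_unique hO h4 h4' (hS.emission_mem h5 h6) (hS.emission_mem h5' h6')
  exact ⟨q, h2, h3 hH⟩

/-- Item `k` is delivered to every node at the planned date. -/
theorem IsAdmissible.exists_delivered [Finite V] (hS : S.IsAdmissible)
    (hO : fastestBroadcast.RequestsInOrder S) (hk : k < S.numRequests) (v : V)
    (hv : v ≠ S.source) :
    ∃ u q, S.Delivered S.run u v (S.arrivalDate k v - S.graph.delay) q ∧ q.item = some k := by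
  induction v using TVG.label_induction (S.arrivalDate k) with | h v ih => ?_
  obtain ⟨u, hpar, hle, hcross⟩ := hS.isSound.exists_parent v hv
  have hd := S.graph.delay_pos
  obtain ⟨he1, he2⟩ := hS.emission_mem (k := k) rfl hpar
  have hst := hS.start_le_broadcastDate hO hk u
  have hcross' : S.graph.Crossable u v (S.arrivalDate k v - S.graph.delay) := by
    rw [arrivalDate_eq_reach]
    exact hcross _
  suffices h : ∃ q, S.run u v (S.arrivalDate k v - S.graph.delay) = some q ∧ q.item = some k by
    obtain ⟨q, h1, h2⟩ := h
    exact ⟨u, q, ⟨h1, hcross'⟩, h2⟩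
  by_cases hu : u = S.source
  · subst hu
    have hc := hS.current hO he1 he2.le
    refine hS.exists_run_item hO (hst.trans he1) (pl := S.scheme.toPlan) ⟨hpar, Or.inl
      ⟨_, _, (isLatest_iff hO hk hc).2 ⟨rfl, rfl⟩, hS.isBase_iff.2 ⟨he1, rfl⟩, ?_, ?_⟩⟩
      (Or.inl ⟨rfl, hk, hc.1⟩)
    · rw [hS.view_scheme_of_le he1]
    · change S.arrivalDate k v - S.graph.delay - S.start S.source =
        S.broadcastDate k - S.start S.source + S.scheme.arrival (S.ident v) - S.graph.delay
      rw [arrivalDate]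
      ring
  -- A relay got the item from its own parent exactly at its planned date, with the plan, and so
  -- computes the right moment to forward it.
  · have hlt : S.arrivalDate k u + S.graph.delay ≤ S.arrivalDate k v := by
      simp only [arrivalDate]
      linarith
    obtain ⟨w, q, h1, h2⟩ := ih u (by linarith) hu
    obtain ⟨-, h3, -, -⟩ := hS.run_item h1.1 h2
    have h0 := hS.arrival_nonneg u
    refine hS.exists_run_item hO (hst.trans he1) (pl := S.scheme.toPlan) ⟨hpar, Or.inr
      ⟨S.ident w, S.arrivalDate k u - S.start u, q, mem_received.2 ⟨?_, ?_, w, rfl, ?_⟩, h2,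
        h3.symm, ?_⟩⟩ (Or.inr ⟨w, _, q, h1, h2, by linarith⟩)
    · rw [arrivalDate]
      linarith
    · linarith
    · rwa [add_sub_cancel]
    · change S.arrivalDate k v - S.graph.delay - S.start u = S.arrivalDate k u - S.start u +
        (S.scheme.arrival (S.ident v) - S.graph.delay - S.scheme.arrival (S.ident u))
      simp only [arrivalDate]
      ring

/-! ### Properties of the broadcasts -/

theorem IsAdmissible.receptionDate [Finite V] (hS : S.IsAdmissible)
    (hO : fastestBroadcast.RequestsInOrder S) (hk : k < S.numRequests) (hv : v ≠ S.source) :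
    fastestBroadcast.ReceptionDate S k v (S.arrivalDate k v) := by
  constructor
  · obtain ⟨u, q, h1, h2⟩ := hS.exists_delivered hO hk v hv
    exact Or.inr ⟨u, _, q, h1, h2, by linarith⟩
  · rintro t (⟨h, -⟩ | ⟨u, s, q, h1, h2, h3⟩)
    · exact absurd h hv
    · obtain ⟨-, -, rfl, -⟩ := hS.run_item h1.1 h2
      linarith

theorem IsAdmissible.emits [Finite V] (hS : S.IsAdmissible)
    (h : S.Emits (fastestBroadcast.traffic S) k u v t) :
    t = S.arrivalDate k v - S.graph.delay ∧
      S.scheme.parent (S.ident v) = some (S.ident u) := by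
  obtain ⟨q, h1, h2⟩ := h
  exact (hS.run_item (q := q) h1 h2).2.2

theorem IsAdmissible.detectsTermination [Finite V] (hS : S.IsAdmissible)
    (hO : fastestBroadcast.RequestsInOrder S) (hk : k < S.numRequests) :
    fastestBroadcast.DetectsTermination S k := by
  have hd : 0 ≤ S.scheme.duration := (hS.arrival_nonneg S.source).trans (hS.isSound.arrival_le _)
  refine ⟨S.broadcastDate k + S.scheme.duration, hS.current hO (by linarith) le_rfl,
    fun t ht => hS.terminal_iff hO hk ht, fun t ht hle v => ?_, fun v => ?_⟩
  · change S.run S.source v t = none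
    by_contra hne
    obtain ⟨q, hq⟩ := Option.ne_none_iff_exists'.1 hne
    obtain ⟨-, -, -, ⟨k', h1, -⟩ | ⟨h1, -⟩⟩ := run_some hq
    · obtain ⟨h2, -, h3, h4⟩ := hS.sendsItem h1
      obtain ⟨h5, h6⟩ := hS.emission_mem h3 h4
      -- Emissions of earlier items ended before this request, those of item `k` before termination,
      -- and those of later items follow the next request.
      rcases lt_trichotomy k' k with h | rfl | h
      · linarith [hS.finish_lt_request hO h hk, hS.request_le k]
      · linarith
      · have := ht.2 (by omega)
        linarith [request_mono hO h h2, hS.request_le k']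
    · have : (k, S.request k - S.start S.source) ∈ (S.view S.run S.source t).requests :=
        mem_requests.2 ⟨rfl, hk, rfl, ht.1⟩
      rw [h1.1] at this
      exact this
  · by_cases hv : v = S.source
    · exact Or.inl ⟨hv, hk, by linarith [hS.request_le k]⟩
    · obtain ⟨u, q, h1, h2⟩ := hS.exists_delivered hO hk v hv
      refine Or.inr ⟨u, _, q, h1, h2, ?_⟩
      have := hS.isSound.arrival_le v
      rw [arrivalDate]
      linarith

theorem IsAdmissible.isArrival [Finite V] (hS : S.IsAdmissible) (k : ℕ) :
    S.graph.IsArrival S.source (S.arrivalDate k) := by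
  rw [arrivalDate_eq_reach]
  exact hS.isSound.isArrival _

theorem IsAdmissible.isForemost [Finite V] (hS : S.IsAdmissible) (k : ℕ) :
    S.graph.IsForemost (S.arrivalDate k) := by
  rw [arrivalDate_eq_reach]
  exact hS.isSound.isForemost _

theorem IsAdmissible.arrivalDate_source [Finite V] (hS : S.IsAdmissible) (k : ℕ) :
    S.arrivalDate k S.source = S.broadcastDate k := by
  rw [arrivalDate, hS.isSound.arrival_source, add_zero]

theorem IsAdmissible.broadcastDate_nonneg [Finite V] (hS : S.IsAdmissible) (k : ℕ) :
    0 ≤ S.broadcastDate k := by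
  have h1 := S.start_nonneg S.source
  have h2 := hS.isSound.base_nonneg
  have h3 := hS.isPeriodic_cycle.1
  rw [broadcastDate, cycleDate]
  positivity

theorem IsAdmissible.isForemostFromMinEccentricity [Finite V] (hS : S.IsAdmissible)
    (hO : fastestBroadcast.RequestsInOrder S) (hk : k < S.numRequests) :
    fastestBroadcast.IsForemostFromMinEccentricity S k := by
  have hx := hS.arrivalDate_source k
  refine ⟨S.broadcastDate k, hS.request_le k, ⟨hS.broadcastDate_nonneg k, S.scheme.duration,
    ?_, fun t ht => ?_⟩, fun u v t h => ?_, fun v hv => ?_⟩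
  · rw [← hx]
    refine (hS.isArrival k).isTemporalEccentricity (hS.isForemost k) (fun v => ?_) ?_
    · have := hS.isSound.arrival_le v
      rw [hx, arrivalDate]
      linarith
    · obtain ⟨v, hv⟩ := hS.isSound.exists_arrival_eq
      exact ⟨v, by rw [hx, arrivalDate, hv]; ring⟩
  -- The eccentricity at an arbitrary date is the duration of the foremost labelling from it, and
  -- the scheme is optimal against this labelling.
  · obtain ⟨α, h1, h2, rfl⟩ :=
      TVG.exists_isForemost hS.isPeriodic_cycle hS.connected S.source ht
    have : Nonempty V := ⟨S.source⟩
    obtain ⟨w, hw⟩ := Finite.exists_max α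
    obtain ⟨w', hw'⟩ := hS.isSound.optimal α ht h1
    exact ⟨α w - α S.source, h1.isTemporalEccentricity h2 (fun v => by linarith [hw v])
      ⟨w, rfl⟩, by linarith [hw w']⟩
  · obtain ⟨h1, h2⟩ := hS.emits h
    exact (hS.emission_mem h1 h2).1
  · refine ⟨S.scheme.arrival (S.ident v), ?_, hS.receptionDate hO hk hv⟩
    have := (hS.isArrival k).isTemporalDistance (hS.isForemost k) v
    rwa [hx, arrivalDate, add_sub_cancel_left] at this

theorem IsAdmissible.duration_pos [Finite V] [Nontrivial V] (hS : S.IsAdmissible) :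
    0 < S.scheme.duration := by
  obtain ⟨v, hv⟩ := exists_ne S.source
  exact S.graph.delay_pos.trans_le ((hS.delay_le_arrival hv).trans (hS.isSound.arrival_le v))

/-- Some node is reached by a message sent at the very beginning of the broadcast. -/
theorem IsAdmissible.exists_arrival_eq_delay [Finite V] [Nontrivial V] (hS : S.IsAdmissible) :
    ∃ v, v ≠ S.source ∧ S.scheme.arrival (S.ident v) = S.graph.delay := by
  classical
  obtain ⟨v₀, hv₀⟩ := exists_ne S.source
  have : Nonempty {v // v ≠ S.source} := ⟨⟨v₀, hv₀⟩⟩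
  obtain ⟨⟨v, hv⟩, hmin⟩ := Finite.exists_min fun v : {v // v ≠ S.source} =>
    S.scheme.arrival (S.ident v)
  refine ⟨v, hv, ?_⟩
  have hd := S.graph.delay_pos
  have hge := hS.delay_le_arrival hv
  have hx := hS.arrivalDate_source 0
  set e := S.arrivalDate 0 v - S.graph.delay with he
  have heB : S.broadcastDate 0 ≤ e := by
    rw [he, arrivalDate]
    linarith
  have hmin' : ∀ w, w ≠ S.source → S.arrivalDate 0 v ≤ S.arrivalDate 0 w := by
    intro w hw
    have : S.scheme.arrival (S.ident v) ≤ S.scheme.arrival (S.ident w) := hmin ⟨w, hw⟩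
    simp only [arrivalDate]
    linarith
  -- Let the source depart only at `e`, the first crossing in use: no other label changes and
  -- parents remain valid. If `e` were later than the start of the broadcast, the duration would
  -- drop below the minimum.
  have harr : S.graph.IsArrival S.source (Function.update (S.arrivalDate 0) S.source e) := by
    intro w hw
    obtain ⟨u, h1, h2⟩ := hS.isArrival 0 w hw
    refine ⟨u, ?_, ?_⟩
    · rw [Function.update_of_ne hw]
      by_cases hu : u = S.source
      · rw [hu, Function.update_self]
        linarith [hmin' w hw]
      · rwa [Function.update_of_ne hu]
    · rwa [Function.update_of_ne hw]
  obtain ⟨w, hw⟩ := hS.isSound.optimal _ (by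
    rw [Function.update_self]
    exact (hS.broadcastDate_nonneg 0).trans heB) harr
  rw [Function.update_self] at hw
  by_cases hwx : w = S.source
  · rw [hwx, Function.update_self] at hw
    linarith [hS.duration_pos]
  · rw [Function.update_of_ne hwx] at hw
    have h3 := hS.isSound.arrival_le w
    have h4 : S.arrivalDate 0 w = S.broadcastDate 0 + S.scheme.arrival (S.ident w) := rfl
    have h5 : S.arrivalDate 0 v = S.broadcastDate 0 + S.scheme.arrival (S.ident v) := rfl
    linarith

theorem IsAdmissible.isFastest [Finite V] (hS : S.IsAdmissible)
    (hO : fastestBroadcast.RequestsInOrder S) (hk : k < S.numRequests) :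
    fastestBroadcast.IsFastest S k := by
  intro _
  have hx := hS.arrivalDate_source k
  refine ⟨S.broadcastDate k, S.broadcastDate k + S.scheme.duration, hS.request_le k,
    ⟨?_, ?_⟩, ⟨?_, ?_⟩, ?_⟩
  · obtain ⟨v, hv, hv'⟩ := hS.exists_arrival_eq_delay
    obtain ⟨u, q, h1, h2⟩ := hS.exists_delivered hO hk v hv
    refine ⟨u, v, q, ?_, h2⟩
    have := h1.1
    rwa [arrivalDate, hv', add_sub_cancel_right] at this
  · rintro t ⟨u, v, h⟩
    obtain ⟨h1, h2⟩ := hS.emits h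
    exact (hS.emission_mem h1 h2).1
  · obtain ⟨v, hv⟩ := hS.isSound.exists_arrival_eq
    have hvx : v ≠ S.source := by
      rintro rfl
      rw [hS.isSound.arrival_source] at hv
      exact hS.duration_pos.ne hv
    refine ⟨v, hvx, ?_⟩
    rw [← hv]
    exact hS.receptionDate hO hk hvx
  · rintro a ⟨v, hv, ha⟩
    rw [ha.unique (hS.receptionDate hO hk hv), arrivalDate]
    linarith [hS.isSound.arrival_le v]
  · rw [add_sub_cancel_left]
    refine ⟨⟨hS.duration_pos.le, S.broadcastDate k, hS.broadcastDate_nonneg k, fun v hv => ?_⟩, ?_⟩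
    · obtain ⟨d, h1, h2⟩ := (hS.isArrival k).exists_journey v hv
      refine ⟨d, _, h2, hx ▸ h1, ?_⟩
      rw [arrivalDate]
      linarith [hS.isSound.arrival_le v]
    · rintro D ⟨hD, s, hs, h⟩
      -- Any broadcast from date `s` is bounded below by the foremost labelling from `s`, which
      -- takes at least the planned duration at some node `w`.
      obtain ⟨α, h1, h2, rfl⟩ :=
        TVG.exists_isForemost hS.isPeriodic_cycle hS.connected S.source hs
      obtain ⟨w, hw⟩ := hS.isSound.optimal α hs h1
      by_cases hwx : w = S.source
      · rw [hwx] at hw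
        linarith
      · obtain ⟨d, a, h3, h4, h5⟩ := h w hwx
        linarith [h2.le_of_journey h3 h4]

/-! ### The common spanning tree -/

/-- The broadcast tree. -/
def tree (S : Setting V) : SimpleGraph V where
  Adj u v := u ≠ v ∧ (S.scheme.parent (S.ident v) = some (S.ident u) ∨
    S.scheme.parent (S.ident u) = some (S.ident v))
  symm := ⟨fun _ _ h => ⟨h.1.symm, h.2.symm⟩⟩
  loopless := ⟨fun _ h => h.1 rfl⟩

theorem IsAdmissible.usesOneTree [Finite V] (hS : S.IsAdmissible) :
    fastestBroadcast.UsesOneTree S := by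
  classical
  have hd := S.graph.delay_pos
  have hpar : ∀ u v, S.scheme.parent (S.ident v) = some (S.ident u) → v ≠ S.source ∧
      S.scheme.arrival (S.ident u) + S.graph.delay ≤ S.scheme.arrival (S.ident v) ∧
      S.graph.footprint.Adj u v := by
    intro u v h
    have hv : v ≠ S.source := by
      rintro rfl
      rw [hS.isSound.parent_source] at h
      cases h
    obtain ⟨u', h1, h2, h3⟩ := hS.isSound.exists_parent v hv
    rw [h] at h1
    obtain rfl := S.ident_injective (Option.some.inj h1)
    exact ⟨hv, h2, _, (h3 0).adj⟩
  have hconn : S.tree.Connected := by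
    have : Nonempty V := ⟨S.source⟩
    have key : ∀ v, S.tree.Reachable S.source v := by
      intro v
      induction v using TVG.label_induction (fun v => S.scheme.arrival (S.ident v)) with | h v ih => ?_
      by_cases hv : v = S.source
      · rw [hv]
      · obtain ⟨u, h1, h2, h3⟩ := hS.isSound.exists_parent v hv
        exact (ih u (by linarith)).trans (SimpleGraph.Adj.reachable ⟨(h3 0).ne, Or.inl h1⟩)
    exact ⟨fun u v => (key u).symm.trans (key v)⟩
  refine ⟨S.tree, ?_, SimpleGraph.isTree_iff_connected_and_card.2 ⟨hconn, ?_⟩, ?_⟩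
  · rintro u v ⟨-, h | h⟩
    · exact (hpar u v h).2.2
    · exact (hpar v u h).2.2.symm
  · refine le_antisymm ?_ hconn.card_vert_le_card_edgeSet_add_one
    choose! par hp using hS.isSound.exists_parent
    -- Every edge joins a node other than the source to its parent, so there are at most `Nat.card V
    -- - 1` edges; together with connectedness this makes a tree.
    let f : {v // v ≠ S.source} → S.tree.edgeSet := fun v =>
      ⟨s(par v, v), ⟨((hp v v.2).2.2 0).ne, Or.inl (hp v v.2).1⟩⟩
    have hf : Function.Surjective f := by
      have key : ∀ u v (h : S.tree.Adj u v), S.scheme.parent (S.ident v) = some (S.ident u) →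
          ∃ a, f a = ⟨s(u, v), h⟩ := by
        intro u v h h1
        obtain ⟨hv, -⟩ := hpar u v h1
        refine ⟨⟨v, hv⟩, ?_⟩
        have h2 := (hp v hv).1
        rw [h1] at h2
        have := S.ident_injective (Option.some.inj h2)
        simp only [f, ← this]
      rintro ⟨e, he⟩
      induction e using Sym2.ind with | h u v => ?_
      rcases he.2 with h | h
      · exact key u v he h
      · obtain ⟨a, ha⟩ := key v u (SimpleGraph.Adj.symm he) h
        exact ⟨a, ha.trans (Subtype.ext Sym2.eq_swap)⟩
    have h1 := Nat.card_le_card_of_surjective f hf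
    have h2 : Nat.card {v // v ≠ S.source} + 1 = Nat.card V := by
      have := Fintype.ofFinite V
      rw [Nat.card_eq_fintype_card, Nat.card_eq_fintype_card, Fintype.card_subtype_compl,
        Fintype.card_subtype_eq]
      have := Fintype.card_pos_iff.2 ⟨S.source⟩
      omega
    omega
  · intro k _ u v t h
    have h1 := (hS.emits h).2
    exact ⟨(hpar u v h1).2.2.ne, Or.inl h1⟩

/-! ### Finiteness of the traffic -/

theorem finite_progression {c q : ℝ} (hq : 0 < q) (b : ℝ) :
    {t : ℝ | t ≤ b ∧ ∃ n : ℕ, t = c + n * q}.Finite := by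
  obtain ⟨N, hN⟩ := exists_nat_ge ((b - c) / q)
  refine ((Set.finite_Iic N).image fun n : ℕ => c + n * q).subset ?_
  rintro t ⟨ht, n, rfl⟩
  refine ⟨n, ?_, rfl⟩
  rw [div_le_iff₀ hq] at hN
  have : (n : ℝ) * q ≤ N * q := by linarith
  exact_mod_cast le_of_mul_le_mul_right this hq

/-- Item packets leave at planned dates, one for each item and receiver; reports leave along
finitely many arithmetic progressions, whose steps are positive because they are window periods. -/
theorem IsAdmissible.finitelyManySends [Finite V] (hS : S.IsAdmissible) :
    fastestBroadcast.FinitelyManySends S := by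
  intro b
  let c : V → V → ℝ × ℝ := fun u v => slot S.periodBound S.graph.delay (S.report u u) (S.ident v)
  have h1 : (⋃ uv : V × V, {t : ℝ | 0 < (c uv.1 uv.2).2 ∧ t ≤ b ∧
      ∃ n : ℕ, t = S.start uv.1 + (c uv.1 uv.2).1 + n * (c uv.1 uv.2).2}).Finite := by
    refine Set.finite_iUnion fun uv => ?_
    by_cases hc : 0 < (c uv.1 uv.2).2
    · exact (finite_progression hc b).subset fun t ht => ht.2
    · exact Set.finite_empty.subset fun t ht => hc ht.1
  have h2 : (⋃ v : V, (fun k => S.arrivalDate k v - S.graph.delay) ''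
      Set.Iio S.numRequests).Finite :=
    Set.finite_iUnion fun v => (Set.finite_Iio _).image _
  refine (h1.union h2).subset ?_
  rintro t ⟨ht, u, v, hne⟩
  obtain ⟨q, hq⟩ := Option.ne_none_iff_exists'.1 (show S.run u v t ≠ none from hne)
  obtain ⟨-, -, -, ⟨k, h3, -⟩ | ⟨⟨-, h3, h4, n, h5⟩, -⟩⟩ := run_some hq
  · obtain ⟨h4, -, h5, -⟩ := hS.sendsItem h3
    exact Or.inr (Set.mem_iUnion.2 ⟨v, k, h4, h5.symm⟩)
  · rw [ownReport_view h3] at h4 h5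
    refine Or.inl (Set.mem_iUnion.2 ⟨(u, v), h4.2.1.1, ht, n, ?_⟩)
    have h5' : t - S.start u = (c u v).1 + n * (c u v).2 := h5
    linarith

end Setting

theorem mainTheorem11 :
    ∃ A : Protocol, ∀ (V : Type) [Finite V] (S : Setting V) (p : ℝ),
      S.graph.footprint.Connected → S.graph.IsPeriodic p → p ≤ S.periodBound →
      A.RequestsInOrder S →
        A.FinitelyManySends S ∧
        (∀ k : ℕ, k < S.numRequests →
          A.DetectsTermination S k ∧ A.IsFastest S k ∧ A.IsForemostFromMinEccentricity S k) ∧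
        A.UsesOneTree S := by
  refine ⟨fastestBroadcast, fun V _ S p hconn hp hP hO => ?_⟩
  have hS : S.IsAdmissible := ⟨hconn, p, hp, hP⟩
  exact ⟨hS.finitelyManySends, fun k hk => ⟨hS.detectsTermination hO hk, hS.isFastest hO hk,
    hS.isForemostFromMinEccentricity hO hk⟩, hS.usesOneTree⟩
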